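/- **Theorem 1 (Bessel function).** For real $\nu>-1$ and $x>0$ let $J_\nu(x)=\left(\frac x2\right)^{\nu}\sum_{n=0}^\infty\frac{(-1)^n}{\Gamma(n+\nu+1)\,n!}\left(\frac x2\right)^{2n}$ be the Bessel function of the first kind. Let $a>0$, $\nu>-1$, and let $\varphi$ be a real- or complex-valued piecewise continuously differentiable function on $(0,\infty)$; that is, apart from a set of points of which only finitely many lie in any compact subinterval of $(0,\infty)$, $\varphi$ is continuously differentiable on $(0,\infty)$, and at each exceptional point $\varphi$ and $\varphi'$ have finite one-sided limits from both sides. Assume that (i) $\int_1^\infty x^{-1/2}|\varphi(x)|\,dx<\infty$, and (ii) $\int_0^1 x^{1/2}|\varphi(x)|\,dx<\infty$ if $\nu\ge-\tfrac12$, or (ii') $\int_0^1 x^{\nu+1}|\varphi(x)|\,dx<\infty$ if $-1<\nu<-\tfrac12$. Then, for every $R>0$, the integrals in the following formula converge absolutely, the one-sided limits $\varphi(a^+)$ and $\varphi(a^-)$ exist, and $$\lim_{R\to\infty}\int_0^\infty \varphi(x)\,x\left(\int_0^R J_\nu(xt)\,J_\nu(at)\,t\,dt\right)dx=\tfrac12\left[\varphi(a^+)+\varphi(a^-)\right].$$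 -/

import Mathlib

open Set Filter Topology MeasureTheory

/-- The Bessel function of the first kind of real order `ν`, at a positive argument `x`, by its
ascending series `(x/2)^ν ∑ (-1)^n / (Γ(n+ν+1) n!) (x/2)^(2n)`. -/
noncomputable def besselJ (ν x : ℝ) : ℝ :=
  (x / 2) ^ ν *
    ∑' n : ℕ, (-1) ^ n / (Real.Gamma (n + ν + 1) * (n.factorial : ℝ)) * (x / 2) ^ (2 * n)

/-- `φ` is piecewise continuously differentiable on `(0, ∞)`: there is a set `S` of exceptional
points, finitely many in each compact subinterval of `(0, ∞)`, such that `φ` is continuously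
differentiable on `(0, ∞)` away from `S`, and both `φ` and its derivative have finite one-sided
limits from the left and from the right at each point of `S` in `(0, ∞)`. The values of `φ` at the
points of `S` are unrestricted. -/
def PiecewiseC1OnPos {𝕜 : Type*} [RCLike 𝕜] (φ : ℝ → 𝕜) : Prop :=
  ∃ S : Set ℝ,
    (∀ c d : ℝ, 0 < c → (S ∩ Icc c d).Finite) ∧
    ContDiffOn ℝ 1 φ (Ioi 0 \ S) ∧
    ∀ s ∈ S, 0 < s →
      (∃ l : 𝕜, Tendsto φ (𝓝[<] s) (𝓝 l)) ∧
      (∃ l : 𝕜, Tendsto φ (𝓝[>] s) (𝓝 l)) ∧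
      (∃ l : 𝕜, Tendsto (deriv φ) (𝓝[<] s) (𝓝 l)) ∧
      (∃ l : 𝕜, Tendsto (deriv φ) (𝓝[>] s) (𝓝 l))

/-! The complex function W(z) = √z (J_ν(z) + i J_{ν+1}(z)) satisfies W' = iW + ((ν+1/2)/z) W̄, so
W(z) = e^{iz} A(z) with an amplitude A that varies slowly and has a limit at infinity
(`exists_tendsto_besselAmp`). No explicit asymptotic expansion of J_ν is needed.

Lommel's integral evaluates the inner integral in closed form. Rewritten through W and A, it splits
x ∫_0^R J_ν(xt) J_ν(at) t dt into a fixed weight times three terms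
(`mul_integral_besselJ_mul_besselJ`): a Dirichlet kernel sin(R(x-a))/(x-a) with coefficient
|A(aR)|², an error carrying A(xR) - A(aR), and a nonsingular oscillating term. The error vanishes in
the limit by dominated convergence, the third term by the Riemann–Lebesgue lemma, and the first
localizes at a because φ approaches its one-sided limits at a linear rate.

Hence the integral equals D(R) · ½(φ(a⁺)+φ(a⁻)) + o(1), where D(R) = `dirichletFactor` does not
depend on φ (`tendsto_setIntegral_hankelKernel_sub`). Instead of computing |lim A| and the Dirichlet
integral, D(R) → 1 is read off from one test function: x^ν e^{-x²/2} is its own Hankel transform, so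
the inversion formula is known for it directly (`tendsto_dirichletFactor`). -/

/-! ### The Bessel series, its recurrences and derivatives. -/

/-- The entire function `∑ (-1)^n y^n / (Γ(n+ν+1) n!)`. -/
noncomputable def besselSeries (ν y : ℝ) : ℝ :=
  ∑' n : ℕ, (-1) ^ n / (Real.Gamma (n + ν + 1) * (n.factorial : ℝ)) * y ^ n

theorem HasSum.congr_of_eq {f g : ℕ → ℝ} {a : ℝ} (h : HasSum f a) (hfg : ∀ n, g n = f n) :
    HasSum g a :=
  (funext hfg : g = f) ▸ h

theorem besselJ_eq_rpow_mul_besselSeries (ν x : ℝ) :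
    besselJ ν x = (x / 2) ^ ν * besselSeries ν ((x / 2) ^ 2) := by
  simp only [besselJ, besselSeries, pow_mul]

theorem besselSeries_coeff_succ {ν : ℝ} (hν : -1 < ν) (n : ℕ) :
    (-1 : ℝ) ^ (n + 1) / (Real.Gamma ((n + 1 : ℕ) + ν + 1) * ((n + 1).factorial : ℝ)) * (n + 1 : ℕ)
      = -((-1) ^ n / (Real.Gamma (n + (ν + 1) + 1) * (n.factorial : ℝ))) := by
  have hn : (0 : ℝ) ≤ n := n.cast_nonneg
  have h1 : Real.Gamma (n + (ν + 1) + 1) ≠ 0 := (Real.Gamma_pos_of_pos (by linarith)).ne'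
  have h2 : ((n + 1 : ℕ) : ℝ) + ν + 1 = n + (ν + 1) + 1 := by push_cast; ring
  have h3 : (n.factorial : ℝ) ≠ 0 := by positivity
  rw [h2, Nat.factorial_succ]
  push_cast
  have h4 : (n : ℝ) + 1 ≠ 0 := by positivity
  field_simp
  ring

theorem summable_besselSeries {ν : ℝ} (hν : -1 < ν) (y : ℝ) :
    Summable fun n : ℕ => (-1 : ℝ) ^ n / (Real.Gamma (n + ν + 1) * (n.factorial : ℝ)) * y ^ n := by
  rcases eq_or_ne y 0 with rfl | hy
  · refine summable_of_ne_finset_zero (s := {0}) fun n hn => ?_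
    rw [zero_pow (by simpa using hn), mul_zero]
  have hG : ∀ n : ℕ, Real.Gamma (n + ν + 1) ≠ 0 := fun n =>
    (Real.Gamma_pos_of_pos (by have : (0 : ℝ) ≤ n := n.cast_nonneg
                               linarith)).ne'
  refine summable_of_ratio_test_tendsto_lt_one (l := 0) zero_lt_one ?_ ?_
  · refine Eventually.of_forall fun n => ?_
    have := hG n
    positivity
  · have key : ∀ n : ℕ, ‖(-1 : ℝ) ^ (n + 1) /
          (Real.Gamma ((n + 1 : ℕ) + ν + 1) * ((n + 1).factorial : ℝ)) * y ^ (n + 1)‖ /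
        ‖(-1 : ℝ) ^ n / (Real.Gamma (n + ν + 1) * (n.factorial : ℝ)) * y ^ n‖
        = |y| * ((n + ν + 1)⁻¹ * ((n : ℝ) + 1)⁻¹) := by
      intro n
      have hn : (0 : ℝ) ≤ n := n.cast_nonneg
      have h0 : (n : ℝ) + ν + 1 ≠ 0 := by linarith
      have h1 : Real.Gamma ((n + 1 : ℕ) + ν + 1) = (n + ν + 1) * Real.Gamma (n + ν + 1) := by
        rw [← Real.Gamma_add_one h0]; push_cast; ring_nf
      rw [← norm_div, h1, Nat.factorial_succ]
      have := hG n
      have h3 : (n.factorial : ℝ) ≠ 0 := by positivity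
      have h4 : (n : ℝ) + 1 ≠ 0 := by positivity
      have h5 : (-1 : ℝ) ^ (n + 1) / ((n + ν + 1) * Real.Gamma (n + ν + 1) *
          (((n + 1) * n.factorial : ℕ) : ℝ)) * y ^ (n + 1) /
          ((-1) ^ n / (Real.Gamma (n + ν + 1) * (n.factorial : ℝ)) * y ^ n)
          = - y * ((n + ν + 1)⁻¹ * ((n : ℝ) + 1)⁻¹) := by
        push_cast
        field_simp
        ring
      rw [h5, norm_mul, norm_neg, Real.norm_eq_abs, Real.norm_of_nonneg]
      have : 0 < (n : ℝ) + ν + 1 := by linarith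
      positivity
    simp only [key]
    rw [show (0 : ℝ) = |y| * (0 * 0) by simp]
    refine Tendsto.const_mul _ (Tendsto.mul ?_ ?_)
    · refine tendsto_inv_atTop_zero.comp ?_
      simp only [add_assoc]
      exact tendsto_atTop_add_const_right _ _ tendsto_natCast_atTop_atTop
    · exact tendsto_inv_atTop_zero.comp
        (tendsto_atTop_add_const_right _ _ tendsto_natCast_atTop_atTop)

/-- Termwise differentiation followed by an index shift, which raises the order by one. Uniform
control comes from the value of the derived series at the larger radius |y| + 1. -/
theorem hasDerivAt_besselSeries {ν : ℝ} (hν : -1 < ν) (y : ℝ) :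
    HasDerivAt (besselSeries ν) (-besselSeries (ν + 1) y) y := by
  set a : ℕ → ℝ := fun n => (-1 : ℝ) ^ n / (Real.Gamma (n + ν + 1) * (n.factorial : ℝ)) with ha
  set b : ℕ → ℝ := fun n =>
    (-1 : ℝ) ^ n / (Real.Gamma (n + (ν + 1) + 1) * (n.factorial : ℝ)) with hb
  have hab : ∀ n, a (n + 1) * (n + 1 : ℕ) = - b n := besselSeries_coeff_succ hν
  set r := |y| + 1 with hr
  have hr0 : 0 < r := by positivity
  have hsb : ∀ z, Summable fun n => b n * z ^ n := summable_besselSeries (by linarith : -1 < ν + 1)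
  have hder : HasDerivAt (fun z => ∑' n, a n * z ^ n) (∑' n, a n * (n * y ^ (n - 1))) y := by
    refine hasDerivAt_tsum_of_isPreconnected (t := Metric.ball (0 : ℝ) r) (y₀ := y)
      (u := fun n => ‖a n * (n * r ^ (n - 1))‖) ?_ Metric.isOpen_ball
      (convex_ball _ _).isPreconnected (fun n z _ => ((hasDerivAt_pow n z).const_mul _)) ?_ ?_
      (summable_besselSeries hν y) ?_
    · refine (summable_nat_add_iff 1).1 ?_
      refine ((hsb r).norm).congr fun n => ?_
      rw [← norm_neg, ← neg_mul, ← hab]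
      simp [mul_assoc]
    · intro n z hz
      have hz' : ‖z‖ ≤ r := by simpa using (mem_ball_zero_iff.1 hz).le
      simp only [norm_mul, norm_pow, Real.norm_of_nonneg hr0.le]
      gcongr
    · simp [hr]
    · simp [hr]
  refine hder.congr_deriv ?_
  have hs : Summable fun n : ℕ => a n * (n * y ^ (n - 1)) := by
    refine (summable_nat_add_iff 1).1 ((hsb y).neg.congr fun n => ?_)
    rw [← neg_mul, ← hab]
    simp [mul_assoc]
  rw [hs.tsum_eq_zero_add, besselSeries, ← tsum_neg]
  simp only [Nat.cast_zero, zero_mul, mul_zero, zero_add, Nat.add_sub_cancel]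
  refine tsum_congr fun n => ?_
  rw [← mul_assoc, hab, neg_mul]

theorem continuous_besselSeries {ν : ℝ} (hν : -1 < ν) : Continuous (besselSeries ν) :=
  continuous_iff_continuousAt.2 fun y => (hasDerivAt_besselSeries hν y).continuousAt

theorem besselSeries_recurrence {ν : ℝ} (hν : -1 < ν) (y : ℝ) :
    besselSeries ν y = (ν + 1) * besselSeries (ν + 1) y - y * besselSeries (ν + 1 + 1) y := by
  have h1 : -1 < ν + 1 := by linarith
  have h2 : -1 < ν + 1 + 1 := by linarith
  have hs0 := (summable_besselSeries hν y).hasSum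
  have hs1 := ((summable_besselSeries h1 y).hasSum).mul_left (ν + 1)
  have hs2 := ((summable_besselSeries h2 y).hasSum).mul_left y
  -- The factor n removes the zeroth term, so multiplication by y becomes an index shift.
  have hs3 : HasSum (fun n : ℕ => -(n : ℝ) * ((-1) ^ n /
      (Real.Gamma (n + (ν + 1) + 1) * (n.factorial : ℝ)) * y ^ n))
      (y * besselSeries (ν + 1 + 1) y) := by
    refine (hasSum_nat_add_iff' 1).1 ?_
    simp only [Finset.range_one, Finset.sum_singleton, Nat.cast_zero, neg_zero, zero_mul, sub_zero]
    refine hs2.congr_of_eq fun n => ?_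
    have := besselSeries_coeff_succ h1 n
    linear_combination (-y ^ (n + 1)) * this
  refine hs0.unique ((hs1.sub hs3).congr_of_eq fun n => ?_)
  have hn : (0 : ℝ) ≤ n := n.cast_nonneg
  have h0 : (n : ℝ) + ν + 1 ≠ 0 := by linarith
  have hG : Real.Gamma (n + ν + 1) ≠ 0 := (Real.Gamma_pos_of_pos (by linarith)).ne'
  have e : Real.Gamma (n + (ν + 1) + 1) = (n + ν + 1) * Real.Gamma (n + ν + 1) := by
    rw [← Real.Gamma_add_one h0]; ring_nf
  have h3 : (n.factorial : ℝ) ≠ 0 := by positivity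
  rw [e]
  field_simp
  ring

theorem measurable_besselJ {ν : ℝ} (hν : -1 < ν) : Measurable (besselJ ν) := by
  have : besselJ ν = fun x => (x / 2) ^ ν * besselSeries ν ((x / 2) ^ 2) :=
    funext (besselJ_eq_rpow_mul_besselSeries ν)
  rw [this]
  have := (continuous_besselSeries hν).measurable
  fun_prop

theorem hasDerivAt_besselJ {ν x : ℝ} (hν : -1 < ν) (hx : 0 < x) :
    HasDerivAt (besselJ ν) (ν / x * besselJ ν x - besselJ (ν + 1) x) x := by
  have hx2 : (0 : ℝ) < x / 2 := by positivity
  have e : besselJ ν = fun x => (x / 2) ^ ν * besselSeries ν ((x / 2) ^ 2) :=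
    funext (besselJ_eq_rpow_mul_besselSeries ν)
  have h1 : HasDerivAt (fun x : ℝ => (x / 2) ^ ν) (1 / 2 * ν * (x / 2) ^ (ν - 1)) x :=
    ((hasDerivAt_id x).div_const 2).rpow_const (Or.inl hx2.ne')
  have h2 : HasDerivAt (fun x : ℝ => (x / 2) ^ 2) (x / 2) x := by
    refine (((hasDerivAt_id x).div_const 2).pow 2).congr_deriv ?_
    simp
    ring
  have h3 := h1.mul ((hasDerivAt_besselSeries hν _).comp x h2)
  rw [besselJ_eq_rpow_mul_besselSeries ν x, besselJ_eq_rpow_mul_besselSeries (ν + 1) x, e]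
  refine h3.congr_deriv ?_
  rw [Real.rpow_add_one hx2.ne', Real.rpow_sub_one hx2.ne']
  simp only [Function.comp]
  field_simp
  ring

/-- The recurrence eliminates the order ν + 2, so that J_ν and J_{ν+1} form a closed first-order
system. -/
theorem hasDerivAt_besselJ_add_one {ν x : ℝ} (hν : -1 < ν) (hx : 0 < x) :
    HasDerivAt (besselJ (ν + 1)) (besselJ ν x - (ν + 1) / x * besselJ (ν + 1) x) x := by
  have hx2 : (0 : ℝ) < x / 2 := by positivity
  refine (hasDerivAt_besselJ (by linarith : -1 < ν + 1) hx).congr_deriv ?_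
  simp only [besselJ_eq_rpow_mul_besselSeries]
  rw [besselSeries_recurrence hν, Real.rpow_add_one hx2.ne' (ν + 1), Real.rpow_add_one hx2.ne']
  field_simp
  ring

/-! ### Amplitude and phase: bounds and the limit of the amplitude. -/

open ComplexConjugate

/-- The complex combination `√z (J_ν(z) + i J_{ν+1}(z))`. -/
noncomputable def besselW (ν z : ℝ) : ℂ :=
  ⟨√z * besselJ ν z, √z * besselJ (ν + 1) z⟩

/-- The slowly varying amplitude `e^{-iz} √z (J_ν(z) + i J_{ν+1}(z))`. -/
noncomputable def besselAmp (ν z : ℝ) : ℂ :=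
  Complex.exp (-(z * Complex.I)) * besselW ν z

theorem hasDerivAt_sqrt_mul_besselJ {ν z : ℝ} (hν : -1 < ν) (hz : 0 < z) :
    HasDerivAt (fun z => √z * besselJ ν z)
      ((ν + 1 / 2) / z * (√z * besselJ ν z) - √z * besselJ (ν + 1) z) z := by
  refine ((Real.hasDerivAt_sqrt hz.ne').mul (hasDerivAt_besselJ hν hz)).congr_deriv ?_
  have h : √z ≠ 0 := (Real.sqrt_pos.2 hz).ne'
  have h2 : z = √z * √z := (Real.mul_self_sqrt hz.le).symm
  have h3 : 1 / (2 * √z) = 1 / 2 / z * √z := by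
    rw [div_mul_eq_mul_div, div_eq_div_iff (by positivity) hz.ne']
    linear_combination h2
  rw [h3]
  ring

theorem hasDerivAt_sqrt_mul_besselJ_add_one {ν z : ℝ} (hν : -1 < ν) (hz : 0 < z) :
    HasDerivAt (fun z => √z * besselJ (ν + 1) z)
      (√z * besselJ ν z - (ν + 1 / 2) / z * (√z * besselJ (ν + 1) z)) z := by
  refine ((Real.hasDerivAt_sqrt hz.ne').mul (hasDerivAt_besselJ_add_one hν hz)).congr_deriv ?_
  have h : √z ≠ 0 := (Real.sqrt_pos.2 hz).ne'
  have h2 : z = √z * √z := (Real.mul_self_sqrt hz.le).symm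
  have h3 : 1 / (2 * √z) = 1 / 2 / z * √z := by
    rw [div_mul_eq_mul_div, div_eq_div_iff (by positivity) hz.ne']
    linear_combination h2
  rw [h3]
  ring

/-- The real system is a pure rotation perturbed by a term of size 1/z. The perturbation acts
through the conjugate, which rotates the opposite way; this is what makes it oscillate after the
phase is removed. -/
theorem hasDerivAt_besselW {ν z : ℝ} (hν : -1 < ν) (hz : 0 < z) :
    HasDerivAt (besselW ν)
      (Complex.I * besselW ν z + ((ν + 1 / 2) / z : ℝ) * conj (besselW ν z)) z := by
  have h1 := (hasDerivAt_sqrt_mul_besselJ hν hz).ofReal_comp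
  have h2 := (hasDerivAt_sqrt_mul_besselJ_add_one hν hz).ofReal_comp.mul_const Complex.I
  have e : besselW ν = (fun y : ℝ => ((√y * besselJ ν y : ℝ) : ℂ)) +
      fun y : ℝ => ((√y * besselJ (ν + 1) y : ℝ) : ℂ) * Complex.I := by
    funext y
    exact (Complex.re_add_im (besselW ν y)).symm
  rw [e]
  refine (h1.add h2).congr_deriv ?_
  rw [← e]
  apply Complex.ext <;> simp [besselW] <;> ring

theorem norm_besselAmp (ν z : ℝ) : ‖besselAmp ν z‖ = ‖besselW ν z‖ := by
  rw [besselAmp, norm_mul, ← neg_mul, ← Complex.ofReal_neg, Complex.norm_exp_ofReal_mul_I, one_mul]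

theorem besselW_eq_exp_mul_besselAmp (ν z : ℝ) :
    besselW ν z = Complex.exp (z * Complex.I) * besselAmp ν z := by
  rw [besselAmp, ← mul_assoc, ← Complex.exp_add, add_neg_cancel, Complex.exp_zero, one_mul]

theorem hasDerivAt_exp_neg_mul_I (z : ℝ) :
    HasDerivAt (fun y : ℝ => Complex.exp (-(y * Complex.I)))
      (-Complex.I * Complex.exp (-(z * Complex.I))) z := by
  have h : HasDerivAt (fun y : ℝ => -((y : ℂ) * Complex.I)) (-Complex.I) z :=
    (((hasDerivAt_id z).ofReal_comp).mul_const Complex.I).neg.congr_deriv (by simp)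
  exact h.cexp.congr_deriv (mul_comm _ _)

theorem hasDerivAt_besselAmp {ν z : ℝ} (hν : -1 < ν) (hz : 0 < z) :
    HasDerivAt (besselAmp ν) (((ν + 1 / 2) / z : ℝ) *
      (Complex.exp (-(z * Complex.I)) * conj (besselW ν z))) z := by
  refine ((hasDerivAt_exp_neg_mul_I z).mul (hasDerivAt_besselW hν hz)).congr_deriv ?_
  ring

/-- A planar system `u' = c u / z - v`, `v' = u - c v / z` has bounded solutions at infinity. -/
theorem exists_bound_of_hasDerivAt_system {c : ℝ} {u v : ℝ → ℝ}
    (hu : ∀ z, 0 < z → HasDerivAt u (c / z * u z - v z) z)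
    (hv : ∀ z, 0 < z → HasDerivAt v (u z - c / z * v z) z) :
    ∃ C, ∀ z, 2 * |c| + 1 ≤ z → u z ^ 2 + v z ^ 2 ≤ C := by
  -- Since (uv)' = u² - v², the correction cancels the 1/z part of (u² + v²)', leaving a derivative
  -- of order 1/z². The exponential factor in `G` then absorbs this remainder and makes `G`
  -- decreasing once z ≥ 2|c| + 1.
  set F : ℝ → ℝ := fun z => u z ^ 2 + v z ^ 2 - 2 * c / z * (u z * v z) with hF
  set G : ℝ → ℝ := fun z => F z * Real.exp (2 * |c| / z) with hG
  have hc := abs_nonneg c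
  have hFd : ∀ z, 0 < z → HasDerivAt F (2 * c / z ^ 2 * (u z * v z)) z := by
    intro z hz
    have h1 := ((hu z hz).pow 2).add ((hv z hz).pow 2)
    have h2 := ((hasDerivAt_inv hz.ne').const_mul (2 * c)).mul ((hu z hz).mul (hv z hz))
    refine (h1.sub h2).congr_deriv ?_
    simp only [Pi.mul_apply]
    field_simp
    ring
  have hGd : ∀ z, 0 < z → HasDerivAt G ((2 * c / z ^ 2 * (u z * v z) - 2 * |c| / z ^ 2 * F z) *
      Real.exp (2 * |c| / z)) z := by
    intro z hz
    have h2 := ((hasDerivAt_inv hz.ne').const_mul (2 * |c|)).exp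
    refine ((hFd z hz).mul h2).congr_deriv ?_
    simp only [div_eq_mul_inv]
    ring
  have huv : ∀ z, |c| * (2 * |u z * v z|) ≤ |c| * (u z ^ 2 + v z ^ 2) := fun z => by
    refine mul_le_mul_of_nonneg_left ?_ hc
    rw [abs_mul]
    nlinarith [sq_nonneg (|u z| - |v z|), sq_abs (u z), sq_abs (v z)]
  have hFl : ∀ z, 2 * |c| + 1 ≤ z → (u z ^ 2 + v z ^ 2) / 2 ≤ F z := by
    intro z hz
    have hz0 : 0 < z := by linarith
    have h1 : 2 * c / z * (u z * v z) ≤ (u z ^ 2 + v z ^ 2) / 2 := by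
      have h2 : 2 * c * (u z * v z) ≤ |c| * (2 * |u z * v z|) := by
        have := le_abs_self (2 * c * (u z * v z))
        rw [abs_mul, abs_mul, abs_two] at this
        linarith
      rw [div_mul_eq_mul_div, div_le_iff₀ hz0]
      have : 0 ≤ u z ^ 2 + v z ^ 2 := by positivity
      nlinarith [huv z]
    simp only [hF]
    linarith
  refine ⟨2 * G (2 * |c| + 1), fun z hz => ?_⟩
  have hanti : AntitoneOn G (Ici (2 * |c| + 1)) := by
    have hpos : ∀ z ∈ Ici (2 * |c| + 1), 0 < z := fun z hz => by
      have : 2 * |c| + 1 ≤ z := hz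
      linarith
    refine antitoneOn_of_deriv_nonpos (convex_Ici _)
      (fun z hz => (hGd z (hpos z hz)).continuousAt.continuousWithinAt)
      (fun z hz => (hGd z (hpos z (interior_subset hz))).differentiableAt.differentiableWithinAt)
      fun z hz => ?_
    have hz' := interior_subset hz
    have hz0 := hpos z hz'
    rw [(hGd z hz0).deriv]
    refine mul_nonpos_of_nonpos_of_nonneg ?_ (Real.exp_pos _).le
    rw [sub_nonpos, div_mul_eq_mul_div, div_mul_eq_mul_div]
    refine div_le_div_of_nonneg_right ?_ (by positivity)
    have h2 : 2 * c * (u z * v z) ≤ |c| * (2 * |u z * v z|) := by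
      have := le_abs_self (2 * c * (u z * v z))
      rw [abs_mul, abs_mul, abs_two] at this
      linarith
    have := mul_le_mul_of_nonneg_left (hFl z hz') hc
    linarith [huv z]
  have h1 := hanti (mem_Ici.2 le_rfl) (mem_Ici.2 hz) hz
  have h2 := hFl z hz
  have hz0 : 0 < z := by linarith
  have h3 : 0 ≤ F z := le_trans (by positivity) h2
  have h4 : F z ≤ G z := le_mul_of_one_le_right h3 (Real.one_le_exp (by positivity))
  linarith

theorem exists_sqrt_mul_besselJ_le {ν : ℝ} (hν : -1 < ν) (Z : ℝ) :
    ∃ B, 0 ≤ B ∧ ∀ z, 0 < z → z ≤ Z → |√z * besselJ ν z| ≤ B * z ^ (ν + 1 / 2) := by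
  obtain ⟨B, hB⟩ := (isCompact_Icc (a := (0 : ℝ)) (b := Z)).exists_bound_of_continuousOn
    (f := fun z => besselSeries ν ((z / 2) ^ 2))
    ((continuous_besselSeries hν).comp (by fun_prop)).continuousOn
  refine ⟨(1 / 2) ^ ν * |B|, by positivity, fun z hz hzZ => ?_⟩
  rw [besselJ_eq_rpow_mul_besselSeries, abs_mul, abs_mul, abs_of_nonneg (Real.sqrt_nonneg _),
    abs_of_nonneg (by positivity : (0 : ℝ) ≤ (z / 2) ^ ν), Real.rpow_add hz, ← Real.sqrt_eq_rpow,
    show z / 2 = z * (1 / 2) by ring, Real.mul_rpow hz.le (by norm_num)]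
  have h := (hB z ⟨hz.le, hzZ⟩).trans (le_abs_self B)
  rw [Real.norm_eq_abs, show z / 2 = z * (1 / 2) by ring] at h
  calc √z * (z ^ ν * (1 / 2) ^ ν * |besselSeries ν ((z * (1 / 2)) ^ 2)|)
      ≤ √z * (z ^ ν * (1 / 2) ^ ν * |B|) := by gcongr
    _ = _ := by ring

theorem one_add_rpow_mul_le {x y : ℝ} (e : ℝ) (hx : 0 ≤ x) (hy : 0 ≤ y) :
    1 + (x * y) ^ e ≤ (1 + x ^ e) * (1 + y ^ e) := by
  rw [Real.mul_rpow hx hy]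
  nlinarith [Real.rpow_nonneg hx e, Real.rpow_nonneg hy e]

theorem norm_besselW_le (ν z : ℝ) :
    ‖besselW ν z‖ ≤ |√z * besselJ ν z| + |√z * besselJ (ν + 1) z| :=
  Complex.norm_le_abs_re_add_abs_im _

theorem exists_norm_besselW_le_of_ge {ν : ℝ} (hν : -1 < ν) :
    ∃ C, 0 ≤ C ∧ ∀ z, 2 * |ν + 1 / 2| + 1 ≤ z → ‖besselW ν z‖ ≤ C := by
  obtain ⟨C, hC⟩ := exists_bound_of_hasDerivAt_system (c := ν + 1 / 2)
    (fun z hz => hasDerivAt_sqrt_mul_besselJ hν hz)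
    (fun z hz => hasDerivAt_sqrt_mul_besselJ_add_one hν hz)
  refine ⟨√C, Real.sqrt_nonneg _, fun z hz => Real.le_sqrt_of_sq_le ?_⟩
  rw [← Complex.normSq_eq_norm_sq, Complex.normSq_apply]
  have := hC z hz
  simp only [besselW]
  linarith

/-- Glues boundedness at infinity to the behaviour z^{ν+1/2} at the origin. The exponent is capped
at 0, so a singularity is recorded only when ν < -1/2. -/
theorem exists_norm_besselW_le {ν : ℝ} (hν : -1 < ν) :
    ∃ C, 0 ≤ C ∧ ∀ z, 0 < z → ‖besselW ν z‖ ≤ C * (1 + z ^ min (ν + 1 / 2) 0) := by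
  set e := min (ν + 1 / 2) 0 with he
  set Z := 2 * |ν + 1 / 2| + 1 with hZ
  have hZ0 : 0 < Z := by positivity
  obtain ⟨C, hC0, hC⟩ := exists_norm_besselW_le_of_ge hν
  obtain ⟨B₁, hB₁, h₁⟩ := exists_sqrt_mul_besselJ_le hν Z
  obtain ⟨B₂, hB₂, h₂⟩ := exists_sqrt_mul_besselJ_le (by linarith : -1 < ν + 1) Z
  have hp : ∀ s, e ≤ s → ∀ z, 0 < z → z ≤ Z → z ^ s ≤ Z ^ (s - e) * z ^ e := by
    intro s hs z hz hzZ
    calc z ^ s = z ^ (s - e) * z ^ e := by rw [← Real.rpow_add hz]; ring_nf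
      _ ≤ _ := by gcongr
  set D := B₁ * Z ^ (ν + 1 / 2 - e) + B₂ * Z ^ (ν + 1 + 1 / 2 - e) with hD
  have hD0 : 0 ≤ D := by positivity
  refine ⟨C + D, by positivity, fun z hz => ?_⟩
  have hze : 0 ≤ z ^ e := by positivity
  rcases le_total Z z with h | h
  · have := hC z h
    nlinarith
  · have e1 := h₁ z hz h
    have e2 := h₂ z hz h
    have e3 := mul_le_mul_of_nonneg_left (hp (ν + 1 / 2) (min_le_left _ _) z hz h) hB₁
    have e4 := mul_le_mul_of_nonneg_left
      (hp (ν + 1 + 1 / 2) ((min_le_left _ _).trans (by linarith)) z hz h) hB₂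
    have e5 := norm_besselW_le ν z
    have e6 : ‖besselW ν z‖ ≤ D * z ^ e := by
      rw [hD]; linarith
    nlinarith

/-- The derivative of the amplitude is only O(1/z), but it oscillates like e^{-2iz}. One integration
by parts, in the form of subtracting a correction `ε` that tends to 0, leaves a derivative O(1/z²),
which is integrable. -/
theorem exists_tendsto_besselAmp {ν : ℝ} (hν : -1 < ν) :
    ∃ L, Tendsto (besselAmp ν) atTop (𝓝 L) := by
  obtain ⟨C, hC0, hC⟩ := exists_norm_besselW_le_of_ge hν
  set c := ν + 1 / 2 with hc
  set Z := 2 * |c| + 1 with hZ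
  have hZ0 : 0 < Z := by positivity
  set ε : ℝ → ℂ := fun z => Complex.exp (-(z * Complex.I)) *
    ((((c / 2 : ℝ) : ℂ) * Complex.I * ((z⁻¹ : ℝ) : ℂ)) * conj (besselW ν z)) with hε
  set H : ℝ → ℂ := fun z => besselAmp ν z - ε z with hH
  set H' : ℝ → ℂ := fun z => Complex.exp (-(z * Complex.I)) *
    ((((c / 2 : ℝ) : ℂ) * Complex.I * (((z ^ 2)⁻¹ : ℝ) : ℂ)) *
      (conj (besselW ν z) - c * besselW ν z)) with hH'
  have hder : ∀ z ∈ Ioi Z, HasDerivAt H (H' z) z := by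
    intro z hz
    have hz0 : 0 < z := hZ0.trans hz
    have h1 := (hasDerivAt_inv hz0.ne').ofReal_comp.const_mul (((c / 2 : ℝ) : ℂ) * Complex.I)
    have hw := hasDerivAt_besselW hν hz0
    have h2 : HasDerivAt (fun z => conj (besselW ν z)) (conj (Complex.I * besselW ν z +
        ((ν + 1 / 2) / z : ℝ) * conj (besselW ν z))) z :=
      (Complex.conjCLE : ℂ →L[ℝ] ℂ).hasFDerivAt.comp_hasDerivAt z hw
    have h3 := (hasDerivAt_exp_neg_mul_I z).mul (h1.mul h2)
    refine ((hasDerivAt_besselAmp hν hz0).sub h3).congr_deriv ?_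
    simp only [hH', map_add, map_mul, Complex.conj_I, Complex.conj_conj, Complex.conj_ofReal,
      ← hc, Pi.mul_apply]
    have hzc : (z : ℂ) ≠ 0 := by exact_mod_cast hz0.ne'
    push_cast
    field_simp
    ring_nf
    simp only [Complex.I_sq]
    ring
  have hcont : ContinuousOn (besselW ν) (Ioi Z) := fun z hz =>
    (hasDerivAt_besselW hν (hZ0.trans hz)).continuousAt.continuousWithinAt
  have hint : IntegrableOn H' (Ioi Z) := by
    have hI : IntegrableOn (fun z : ℝ => |c| / 2 * ((1 + |c|) * C) * z ^ (-2 : ℝ)) (Ioi Z) :=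
      (integrableOn_Ioi_rpow_of_lt (by norm_num) hZ0).const_mul _
    refine hI.mono' ?_ ?_
    · refine ContinuousOn.aestronglyMeasurable ?_ measurableSet_Ioi
      have h1 : ContinuousOn (fun z : ℝ => (((z ^ 2)⁻¹ : ℝ) : ℂ)) (Ioi Z) :=
        Complex.continuous_ofReal.comp_continuousOn (ContinuousOn.inv₀ (by fun_prop)
          fun z hz => by have : 0 < z := hZ0.trans hz
                         positivity)
      have h2 : ContinuousOn (fun z : ℝ => conj (besselW ν z)) (Ioi Z) :=
        Complex.continuous_conj.comp_continuousOn hcont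
      exact ContinuousOn.mul (by fun_prop) ((continuousOn_const.mul h1).mul
        (h2.sub (continuousOn_const.mul hcont)))
    · filter_upwards [ae_restrict_mem measurableSet_Ioi] with z hz
      have hz0 : 0 < z := hZ0.trans hz
      have hb := hC z (le_of_lt hz)
      have h1 : ‖conj (besselW ν z) - c * besselW ν z‖ ≤ (1 + |c|) * C := by
        refine (norm_sub_le _ _).trans ?_
        rw [RCLike.norm_conj, norm_mul, Complex.norm_real, Real.norm_eq_abs]
        have := mul_le_mul_of_nonneg_left hb (abs_nonneg c)
        linarith
      simp only [hH', norm_mul, Complex.norm_real, Complex.norm_I, mul_one]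
      rw [← neg_mul, ← Complex.ofReal_neg, Complex.norm_exp_ofReal_mul_I, one_mul,
        Real.norm_of_nonneg (by positivity : (0 : ℝ) ≤ (z ^ 2)⁻¹), Real.norm_eq_abs, abs_div,
        abs_two, Real.rpow_neg hz0.le, Real.rpow_two]
      calc |c| / 2 * (z ^ 2)⁻¹ * ‖conj (besselW ν z) - c * besselW ν z‖
          ≤ |c| / 2 * (z ^ 2)⁻¹ * ((1 + |c|) * C) := by gcongr
        _ = _ := by ring
  have hlim := tendsto_limUnder_of_hasDerivAt_of_integrableOn_Ioi hder hint
  have hε0 : Tendsto ε atTop (𝓝 0) := by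
    refine squeeze_zero_norm' (a := fun z => |c| / 2 * C * z⁻¹) ?_ ?_
    · filter_upwards [eventually_ge_atTop Z] with z hz
      have hz0 : 0 < z := hZ0.trans_le hz
      have hb := hC z hz
      simp only [hε, norm_mul, Complex.norm_real, Complex.norm_I, mul_one]
      rw [← neg_mul, ← Complex.ofReal_neg, Complex.norm_exp_ofReal_mul_I, one_mul,
        Real.norm_of_nonneg (by positivity : (0 : ℝ) ≤ z⁻¹), Real.norm_eq_abs, abs_div,
        abs_two, RCLike.norm_conj]
      calc |c| / 2 * z⁻¹ * ‖besselW ν z‖ ≤ |c| / 2 * z⁻¹ * C := by gcongr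
        _ = _ := by ring
    · simpa using tendsto_inv_atTop_zero.const_mul (|c| / 2 * C)
  refine ⟨limUnder atTop H + 0, (hlim.add hε0).congr fun z => ?_⟩
  simp [hH]

/-- The factor |x - a| is to cancel the pole of the kernel. For x ≥ a/2 it comes from the mean value
inequality: the derivative is of order 1/R and the interval has length |x - a| R. For x ≤ a/2 the
distance |x - a| is at least a/2, and a bound on each amplitude suffices. -/
theorem exists_norm_besselAmp_sub_le {a ν : ℝ} (ha : 0 < a) (hν : -1 < ν) :
    ∃ C, 0 ≤ C ∧ ∀ R x, 0 < R → 0 < x →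
      ‖besselAmp ν (x * R) - besselAmp ν (a * R)‖ ≤
        C * (1 + R ^ min (ν + 1 / 2) 0) * |x - a| * (1 + x ^ min (ν + 1 / 2) 0) := by
  obtain ⟨C, hC0, hC⟩ := exists_norm_besselW_le hν
  set e := min (ν + 1 / 2) 0 with he
  have he0 : e ≤ 0 := min_le_right _ _
  refine ⟨|ν + 1 / 2| * C * (1 + (a / 2) ^ e) * (2 / a) + C * (2 + a ^ e) * (2 / a),
    by positivity, fun R x hR hx => ?_⟩
  have hRe : 0 ≤ R ^ e := by positivity
  have hxe : 0 ≤ x ^ e := by positivity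
  have hae : 0 ≤ a ^ e := by positivity
  rcases le_total (a / 2) x with h | h
  · have hs : ∀ z ∈ Ici (a / 2 * R), 0 < z := fun z hz =>
      lt_of_lt_of_le (by positivity) (mem_Ici.1 hz)
    have hmv := (convex_Ici (a / 2 * R)).norm_image_sub_le_of_norm_hasDerivWithin_le
      (f := besselAmp ν) (C := |ν + 1 / 2| * C * (1 + (a / 2) ^ e) * (2 / a) * (1 + R ^ e) / R)
      (fun z hz => (hasDerivAt_besselAmp hν (hs z hz)).hasDerivWithinAt) (fun z hz => ?_)
      (x := a * R) (y := x * R) (mem_Ici.2 (by gcongr; linarith)) (mem_Ici.2 (by gcongr))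
    · refine hmv.trans ?_
      rw [← sub_mul, norm_mul, Real.norm_eq_abs, Real.norm_of_nonneg hR.le]
      calc |ν + 1 / 2| * C * (1 + (a / 2) ^ e) * (2 / a) * (1 + R ^ e) / R * (|x - a| * R)
          = |ν + 1 / 2| * C * (1 + (a / 2) ^ e) * (2 / a) * (1 + R ^ e) * |x - a| * 1 := by
            field_simp
        _ ≤ _ := by
            gcongr
            · exact le_add_of_nonneg_right (by positivity)
            · linarith
    · have hz0 := hs z hz
      have hz' : a / 2 * R ≤ z := hz
      rw [norm_mul, norm_mul, RCLike.norm_conj, ← neg_mul, ← Complex.ofReal_neg,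
        Complex.norm_exp_ofReal_mul_I, one_mul, Complex.norm_real, Real.norm_eq_abs, abs_div,
        abs_of_pos hz0]
      have h1 : z ^ e ≤ (a / 2 * R) ^ e := Real.rpow_le_rpow_of_nonpos (by positivity) hz' he0
      have h2 := one_add_rpow_mul_le e (by positivity : 0 ≤ a / 2) hR.le
      have h3 : ‖besselW ν z‖ ≤ C * ((1 + (a / 2) ^ e) * (1 + R ^ e)) :=
        (hC z hz0).trans (by gcongr; linarith)
      calc |ν + 1 / 2| / z * ‖besselW ν z‖
          ≤ |ν + 1 / 2| / (a / 2 * R) * (C * ((1 + (a / 2) ^ e) * (1 + R ^ e))) := by gcongr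
        _ = _ := by field_simp
  · have h1 : 1 ≤ 2 / a * |x - a| := by
      rw [abs_sub_comm, abs_of_nonneg (by linarith), div_mul_eq_mul_div, le_div_iff₀ ha]
      linarith
    have h2 : ‖besselAmp ν (x * R)‖ ≤ C * ((1 + x ^ e) * (1 + R ^ e)) := by
      rw [norm_besselAmp]
      exact (hC _ (by positivity)).trans (by gcongr; exact one_add_rpow_mul_le e hx.le hR.le)
    have h3 : ‖besselAmp ν (a * R)‖ ≤ C * ((1 + a ^ e) * (1 + R ^ e)) := by
      rw [norm_besselAmp]
      exact (hC _ (by positivity)).trans (by gcongr; exact one_add_rpow_mul_le e ha.le hR.le)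
    calc ‖besselAmp ν (x * R) - besselAmp ν (a * R)‖
        ≤ C * ((1 + x ^ e) * (1 + R ^ e)) + C * ((1 + a ^ e) * (1 + R ^ e)) :=
          (norm_sub_le _ _).trans (add_le_add h2 h3)
      _ ≤ C * ((1 + x ^ e) * (1 + R ^ e)) + C * ((1 + a ^ e) * (1 + R ^ e)) * (1 + x ^ e) :=
          add_le_add le_rfl (le_mul_of_one_le_right (by positivity) (by linarith))
      _ = C * (2 + a ^ e) * (1 + R ^ e) * (1 + x ^ e) * 1 := by ring
      _ ≤ C * (2 + a ^ e) * (1 + R ^ e) * (1 + x ^ e) * (2 / a * |x - a|) := by gcongr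
      _ = C * (2 + a ^ e) * (2 / a) * (1 + R ^ e) * |x - a| * (1 + x ^ e) := by ring
      _ ≤ _ := by
          gcongr
          exact le_add_of_nonneg_left (by positivity)

/-! ### The inner integral: convergence, Lommel's formula, and its decomposition. -/

/-- The factor t equals √(xt) √(at) / (√x √a), so both Bessel functions turn into real parts of W.
The bound separates x from t, as both the inner integral and the later use of Fubini require. -/
theorem exists_norm_besselJ_mul_besselJ_le {a ν : ℝ} (ha : 0 < a) (hν : -1 < ν) :
    ∃ C, 0 ≤ C ∧ ∀ x t, 0 < x → 0 < t →
      ‖besselJ ν (x * t) * besselJ ν (a * t) * t‖ ≤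
        C * ((√x)⁻¹ * (1 + x ^ min (ν + 1 / 2) 0)) * (1 + t ^ min (ν + 1 / 2) 0) ^ 2 := by
  obtain ⟨C, hC0, hC⟩ := exists_norm_besselW_le hν
  set e := min (ν + 1 / 2) 0 with he
  have hu : ∀ y t, 0 < y → 0 < t →
      |√(y * t) * besselJ ν (y * t)| ≤ C * ((1 + y ^ e) * (1 + t ^ e)) := by
    intro y t hy ht
    refine (Complex.abs_re_le_norm (besselW ν (y * t))).trans ((hC _ (by positivity)).trans ?_)
    gcongr
    exact one_add_rpow_mul_le e hy.le ht.le
  refine ⟨C ^ 2 * (1 + a ^ e) * (√a)⁻¹, by positivity, fun x t hx ht => ?_⟩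
  have hsx : √x ≠ 0 := (Real.sqrt_pos.2 hx).ne'
  have hsa : √a ≠ 0 := (Real.sqrt_pos.2 ha).ne'
  have h1 : besselJ ν (x * t) * besselJ ν (a * t) * t =
      (√(x * t) * besselJ ν (x * t)) * (√(a * t) * besselJ ν (a * t)) * ((√x)⁻¹ * (√a)⁻¹) := by
    rw [Real.sqrt_mul hx.le, Real.sqrt_mul ha.le]
    field_simp
    rw [Real.sq_sqrt ht.le]
    ring
  rw [h1, norm_mul, norm_mul, Real.norm_eq_abs, Real.norm_eq_abs,
    Real.norm_of_nonneg (by positivity : 0 ≤ (√x)⁻¹ * (√a)⁻¹)]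
  calc _ ≤ C * ((1 + x ^ e) * (1 + t ^ e)) * (C * ((1 + a ^ e) * (1 + t ^ e))) *
        ((√x)⁻¹ * (√a)⁻¹) := by
        gcongr
        · exact hu x t hx ht
        · exact hu a t ha ht
    _ = _ := by ring

theorem intervalIntegrable_one_add_rpow_sq {e : ℝ} (he : -1 < 2 * e) (b c : ℝ) (hb : 0 ≤ b)
    (hc : 0 ≤ c) : IntervalIntegrable (fun t : ℝ => (1 + t ^ e) ^ 2) volume b c := by
  have h1 := (intervalIntegral.intervalIntegrable_rpow' (a := b) (b := c) he)
  have h2 := (intervalIntegral.intervalIntegrable_rpow' (a := b) (b := c) (r := e)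
    (by linarith)).const_mul 2
  refine ((intervalIntegrable_const (c := (1 : ℝ))).add (h2.add h1)).congr fun t ht => ?_
  have ht : 0 < t := lt_of_le_of_lt (le_min hb hc) ht.1
  simp only [two_mul e, Real.rpow_add ht]
  ring

theorem neg_one_lt_two_mul_min {ν : ℝ} (hν : -1 < ν) : -1 < 2 * min (ν + 1 / 2) 0 := by
  have : -(1 / 2) < min (ν + 1 / 2) 0 := lt_min (by linarith) (by norm_num)
  linarith

theorem intervalIntegrable_besselJ_mul_besselJ {a ν R x : ℝ} (ha : 0 < a) (hν : -1 < ν)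
    (hR : 0 < R) (hx : 0 < x) :
    IntervalIntegrable (fun t : ℝ => besselJ ν (x * t) * besselJ ν (a * t) * t) volume 0 R := by
  obtain ⟨C, hC0, hC⟩ := exists_norm_besselJ_mul_besselJ_le ha hν
  refine ((intervalIntegrable_one_add_rpow_sq (neg_one_lt_two_mul_min hν) 0 R le_rfl
    hR.le).const_mul (C * ((√x)⁻¹ * (1 + x ^ min (ν + 1 / 2) 0)))).mono_fun' ?_ ?_
  · have := measurable_besselJ hν
    exact (by fun_prop : Measurable _).aestronglyMeasurable
  · rw [uIoc_of_le hR.le]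
    filter_upwards [ae_restrict_mem measurableSet_Ioc] with t ht
    exact hC x t hx ht.1

/-- The boundary term of Lommel's integral at 0: it is t^{2ν+2} times a continuous function, and 2ν
+ 2 > 0. -/
theorem tendsto_mul_besselJ_add_one_mul_besselJ {x a ν : ℝ} (hx : 0 < x) (ha : 0 < a)
    (hν : -1 < ν) :
    Tendsto (fun t : ℝ => t * (besselJ (ν + 1) (x * t) * besselJ ν (a * t))) (𝓝[>] 0) (𝓝 0) := by
  have hE0 := continuous_besselSeries hν
  have hE1 := continuous_besselSeries (by linarith : -1 < ν + 1)
  have h0 : Tendsto (fun t : ℝ => t ^ (2 * ν + 2)) (𝓝[>] 0) (𝓝 0) := by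
    have := (Real.continuousAt_rpow_const 0 (2 * ν + 2) (Or.inr (by linarith))).tendsto
    rw [Real.zero_rpow (by linarith)] at this
    exact this.mono_left nhdsWithin_le_nhds
  have h1 : Continuous fun t : ℝ => (x / 2) ^ (ν + 1) * (a / 2) ^ ν *
      (besselSeries (ν + 1) ((x * t / 2) ^ 2) * besselSeries ν ((a * t / 2) ^ 2)) := by
    fun_prop
  have h2 := h0.mul ((h1.tendsto 0).mono_left (nhdsWithin_le_nhds (s := Ioi 0)))
  rw [zero_mul] at h2
  refine h2.congr' ?_
  filter_upwards [self_mem_nhdsWithin] with t (ht : 0 < t)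
  rw [besselJ_eq_rpow_mul_besselSeries, besselJ_eq_rpow_mul_besselSeries,
    show 2 * ν + 2 = ν + 1 + ν + 1 by ring, Real.rpow_add_one ht.ne', Real.rpow_add ht,
    mul_div_right_comm x, mul_div_right_comm a, Real.mul_rpow (by positivity) ht.le,
    Real.mul_rpow (by positivity) ht.le]
  ring

/-- Lommel's integral. -/
theorem sub_sq_mul_integral_besselJ_mul_besselJ {a ν R x : ℝ} (ha : 0 < a) (hν : -1 < ν)
    (hR : 0 < R) (hx : 0 < x) :
    (x ^ 2 - a ^ 2) * ∫ t in (0 : ℝ)..R, besselJ ν (x * t) * besselJ ν (a * t) * t =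
      R * (x * (besselJ (ν + 1) (x * R) * besselJ ν (a * R)) -
        a * (besselJ (ν + 1) (a * R) * besselJ ν (x * R))) := by
  have hJ : ∀ y, 0 < y → ∀ t, 0 < t → HasDerivAt (fun t => besselJ ν (y * t))
      ((ν / (y * t) * besselJ ν (y * t) - besselJ (ν + 1) (y * t)) * y) t := fun y hy t ht =>
    (hasDerivAt_besselJ hν (mul_pos hy ht)).comp t (hasDerivAt_const_mul y)
  have hJ1 : ∀ y, 0 < y → ∀ t, 0 < t → HasDerivAt (fun t => besselJ (ν + 1) (y * t))
      ((besselJ ν (y * t) - (ν + 1) / (y * t) * besselJ (ν + 1) (y * t)) * y) t :=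
    fun y hy t ht =>
    (hasDerivAt_besselJ_add_one hν (mul_pos hy ht)).comp t (hasDerivAt_const_mul y)
  -- An explicit antiderivative: the terms containing ν and the products J_{ν+1} J_{ν+1} cancel in
  -- the difference.
  have hd : ∀ t, 0 < t → HasDerivAt
      (fun t => x * (t * (besselJ (ν + 1) (x * t) * besselJ ν (a * t))) -
        a * (t * (besselJ (ν + 1) (a * t) * besselJ ν (x * t))))
      ((x ^ 2 - a ^ 2) * (besselJ ν (x * t) * besselJ ν (a * t) * t)) t := by
    intro t ht
    refine ((((hasDerivAt_id t).mul ((hJ1 x hx t ht).mul (hJ a ha t ht))).const_mul x).sub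
      (((hasDerivAt_id t).mul ((hJ1 a ha t ht).mul (hJ x hx t ht))).const_mul a)).congr_deriv ?_
    simp only [id, Pi.mul_apply]
    field_simp
    ring
  have h := intervalIntegral.integral_eq_sub_of_hasDerivAt_of_tendsto hR
    (fun t ht => hd t ht.1)
    ((intervalIntegrable_besselJ_mul_besselJ ha hν hR hx).const_mul (x ^ 2 - a ^ 2))
    (((tendsto_mul_besselJ_add_one_mul_besselJ hx ha hν).const_mul x).sub
      ((tendsto_mul_besselJ_add_one_mul_besselJ ha hx hν).const_mul a))
    ((hd R hR).continuousAt.tendsto.mono_left nhdsWithin_le_nhds)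
  rw [intervalIntegral.integral_const_mul] at h
  rw [h]
  ring

/-- Write W = e^{i·} A and replace A(y) by A(z) + (A(y) - A(z)): freezing the amplitude leaves an
exact sine. -/
theorem im_besselW_mul_conj (ν y z : ℝ) :
    (besselW ν y * conj (besselW ν z)).im = ‖besselAmp ν z‖ ^ 2 * Real.sin (y - z) +
      (Complex.exp ((y - z : ℝ) * Complex.I) * ((besselAmp ν y - besselAmp ν z) *
        conj (besselAmp ν z))).im := by
  have h1 : besselW ν y * conj (besselW ν z) = (‖besselAmp ν z‖ ^ 2 : ℝ) *
      Complex.exp ((y - z : ℝ) * Complex.I) +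
      Complex.exp ((y - z : ℝ) * Complex.I) * ((besselAmp ν y - besselAmp ν z) *
        conj (besselAmp ν z)) := by
    have h2 : Complex.exp ((y - z : ℝ) * Complex.I) =
        Complex.exp (y * Complex.I) * Complex.exp (-(z * Complex.I)) := by
      rw [← Complex.exp_add]
      push_cast
      ring_nf
    have h3 : conj (Complex.exp (z * Complex.I)) = Complex.exp (-(z * Complex.I)) := by
      rw [← Complex.exp_conj]
      simp
    rw [← Complex.normSq_eq_norm_sq, ← Complex.mul_conj, besselW_eq_exp_mul_besselAmp ν y,
      besselW_eq_exp_mul_besselAmp ν z, map_mul, h3, h2]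
    ring
  rw [h1, Complex.add_im, Complex.im_ofReal_mul, Complex.exp_ofReal_mul_I_im]

/-- The factor `√x / (√a (x + a))` of the Hankel kernel. -/
noncomputable def hankelWeight (a x : ℝ) : ℝ := √x / √a / (x + a)

/-- The part of the Hankel kernel produced by the variation of the amplitude. -/
noncomputable def hankelError (ν a R x : ℝ) : ℝ :=
  (Complex.exp ((x * R - a * R : ℝ) * Complex.I) * ((besselAmp ν (x * R) - besselAmp ν (a * R)) *
        conj (besselAmp ν (a * R)))).im / (x - a)

/-- Splitting x = a + (x - a) in Lommel's formula antisymmetrizes the singular part into Im(W(xR)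
conj W(aR)) / (x - a), while the x - a piece loses its denominator and becomes the last term. -/
theorem mul_integral_besselJ_mul_besselJ {a ν R x : ℝ} (ha : 0 < a) (hν : -1 < ν)
    (hR : 0 < R) (hx : 0 < x) (hxa : x ≠ a) :
    x * ∫ t in (0 : ℝ)..R, besselJ ν (x * t) * besselJ ν (a * t) * t =
      hankelWeight a x * (a * (‖besselAmp ν (a * R)‖ ^ 2 * (R * Real.sinc (R * (x - a))) +
        hankelError ν a R x) + (besselW ν (x * R)).im * (besselW ν (a * R)).re) := by
  have hxa' : x - a ≠ 0 := sub_ne_zero.2 hxa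
  have h1 := sub_sq_mul_integral_besselJ_mul_besselJ ha hν hR hx
  have h2 : ‖besselAmp ν (a * R)‖ ^ 2 * (R * Real.sinc (R * (x - a))) + hankelError ν a R x =
      (besselW ν (x * R) * conj (besselW ν (a * R))).im / (x - a) := by
    rw [im_besselW_mul_conj, hankelError, Real.sinc_of_ne_zero (mul_ne_zero hR.ne' hxa'),
      show R * (x - a) = x * R - a * R by ring]
    have : x * R - a * R ≠ 0 := by rw [← sub_mul]; positivity
    field_simp
  have h3 : x + a ≠ 0 := by positivity
  have hsx : √x ≠ 0 := (Real.sqrt_pos.2 hx).ne'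
  have hsa : √a ≠ 0 := (Real.sqrt_pos.2 ha).ne'
  have hsR : √R ≠ 0 := (Real.sqrt_pos.2 hR).ne'
  rw [h2, hankelWeight]
  refine mul_left_cancel₀ (mul_ne_zero hxa' h3) ?_
  have h4 : (x - a) * (x + a) * (x * ∫ t in (0 : ℝ)..R,
      besselJ ν (x * t) * besselJ ν (a * t) * t) =
      x * ((x ^ 2 - a ^ 2) * ∫ t in (0 : ℝ)..R, besselJ ν (x * t) * besselJ ν (a * t) * t) := by
    ring
  rw [h4, h1]
  simp only [besselW, Complex.mul_im, Complex.conj_re, Complex.conj_im]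
  rw [Real.sqrt_mul hx.le, Real.sqrt_mul ha.le]
  field_simp
  rw [Real.sq_sqrt hx.le, Real.sq_sqrt hR.le]
  ring

/-! ### Riemann–Lebesgue lemmas and Dirichlet localization. -/

theorem tendsto_integral_ofReal_mul_cos_and_sin {f : ℝ → ℝ} (hf : Integrable f) :
    Tendsto (fun R : ℝ => ∫ x, f x * Real.cos (R * x)) atTop (𝓝 0) ∧
    Tendsto (fun R : ℝ => ∫ x, f x * Real.sin (R * x)) atTop (𝓝 0) := by
  have h1 := Real.tendsto_integral_exp_smul_cocompact (fun x => (f x : ℂ))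
  have h2 : Tendsto (fun R : ℝ => R / (2 * Real.pi)) atTop (cocompact ℝ) :=
    (tendsto_id.atTop_div_const (by positivity)).mono_right atTop_le_cocompact
  have h3 := h1.comp h2
  have e1 : ∀ R x : ℝ, Real.fourierChar (-(x * (R / (2 * Real.pi)))) • (f x : ℂ) =
      ((f x * Real.cos (R * x) : ℝ) : ℂ) - ((f x * Real.sin (R * x) : ℝ) : ℂ) * Complex.I := by
    intro R x
    rw [Circle.smul_def, Real.fourierChar_apply,
      show 2 * Real.pi * -(x * (R / (2 * Real.pi))) = -(R * x) by field_simp,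
      Complex.exp_mul_I, ← Complex.ofReal_cos, ← Complex.ofReal_sin, Real.cos_neg, Real.sin_neg,
      smul_eq_mul]
    push_cast
    ring
  have hic : ∀ R : ℝ, Integrable fun x => f x * Real.cos (R * x) := fun R =>
    hf.mul_bdd (c := 1) (by fun_prop) (Eventually.of_forall fun x => Real.abs_cos_le_one _)
  have his : ∀ R : ℝ, Integrable fun x => f x * Real.sin (R * x) := fun R =>
    hf.mul_bdd (c := 1) (by fun_prop) (Eventually.of_forall fun x => Real.abs_sin_le_one _)
  have e2 : ∀ R : ℝ, (∫ x, Real.fourierChar (-(x * (R / (2 * Real.pi)))) • (f x : ℂ)) =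
      ((∫ x, f x * Real.cos (R * x) : ℝ) : ℂ) -
        ((∫ x, f x * Real.sin (R * x) : ℝ) : ℂ) * Complex.I := by
    intro R
    simp_rw [e1]
    rw [integral_sub (hic R).ofReal ((his R).ofReal.mul_const _), integral_mul_const,
      integral_complex_ofReal, integral_complex_ofReal]
  simp only [Function.comp_def, e2] at h3
  constructor
  · simpa [Function.comp_def] using (Complex.continuous_re.tendsto _).comp h3
  · simpa [Function.comp_def] using ((Complex.continuous_im.tendsto _).comp h3).neg

theorem tendsto_setIntegral_mul_cos_and_sin {𝕜 : Type*} [RCLike 𝕜] {f : ℝ → 𝕜} {s : Set ℝ}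
    (hs : MeasurableSet s) (hf : IntegrableOn f s) :
    Tendsto (fun R : ℝ => ∫ x in s, f x * ((Real.cos (R * x) : ℝ) : 𝕜)) atTop (𝓝 0) ∧
    Tendsto (fun R : ℝ => ∫ x in s, f x * ((Real.sin (R * x) : ℝ) : 𝕜)) atTop (𝓝 0) := by
  have hg : Integrable (s.indicator f) := hf.integrable_indicator hs
  have key : ∀ c : ℝ → ℝ → ℝ, (∀ R, Continuous (c R)) → (∀ R x, |c R x| ≤ 1) →
      Tendsto (fun R : ℝ => ∫ x, RCLike.re (s.indicator f x) * c R x) atTop (𝓝 0) →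
      Tendsto (fun R : ℝ => ∫ x, RCLike.im (s.indicator f x) * c R x) atTop (𝓝 0) →
      Tendsto (fun R : ℝ => ∫ x in s, f x * ((c R x : ℝ) : 𝕜)) atTop (𝓝 0) := by
    intro c hc hc1 hre him
    have h1 := ((RCLike.continuous_ofReal (K := 𝕜)).tendsto 0).comp hre
    have h2 := (((RCLike.continuous_ofReal (K := 𝕜)).tendsto 0).comp him).mul_const
      (RCLike.I : 𝕜)
    have h3 := h1.add h2
    simp only [RCLike.ofReal_zero, zero_mul, add_zero] at h3
    refine h3.congr fun R => ?_
    have hi : Integrable fun x => s.indicator f x * ((c R x : ℝ) : 𝕜) :=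
      hg.mul_bdd (c := 1) (RCLike.continuous_ofReal.comp (hc R)).aestronglyMeasurable
        (Eventually.of_forall fun x => by simpa using hc1 R x)
    rw [← integral_indicator hs]
    have e : (s.indicator fun x => f x * ((c R x : ℝ) : 𝕜)) =
        fun x => s.indicator f x * ((c R x : ℝ) : 𝕜) := by
      funext x
      exact indicator_mul_left s f _
    rw [e, ← integral_re_add_im hi]
    simp only [RCLike.re_mul_ofReal, RCLike.im_mul_ofReal, Function.comp_apply]
  have hr := tendsto_integral_ofReal_mul_cos_and_sin hg.re
  have hi := tendsto_integral_ofReal_mul_cos_and_sin hg.im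
  exact ⟨key _ (fun R => by fun_prop) (fun R x => Real.abs_cos_le_one _) hr.1 hi.1,
    key _ (fun R => by fun_prop) (fun R x => Real.abs_sin_le_one _) hr.2 hi.2⟩

theorem tendsto_setIntegral_mul_sin_sub {𝕜 : Type*} [RCLike 𝕜] {f : ℝ → 𝕜} {s : Set ℝ}
    (hs : MeasurableSet s) (hf : IntegrableOn f s) (a : ℝ) :
    Tendsto (fun R : ℝ => ∫ x in s, f x * ((Real.sin (R * (x - a)) : ℝ) : 𝕜)) atTop (𝓝 0) := by
  obtain ⟨h1, h2⟩ := tendsto_setIntegral_mul_cos_and_sin hs hf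
  have b1 : IsBoundedUnder (· ≤ ·) atTop fun R : ℝ => ‖((Real.cos (R * a) : ℝ) : 𝕜)‖ :=
    isBoundedUnder_of ⟨1, fun R => by simpa using Real.abs_cos_le_one _⟩
  have b2 : IsBoundedUnder (· ≤ ·) atTop fun R : ℝ => ‖((Real.sin (R * a) : ℝ) : 𝕜)‖ :=
    isBoundedUnder_of ⟨1, fun R => by simpa using Real.abs_sin_le_one _⟩
  have h3 := (h2.zero_mul_isBoundedUnder_le b1).sub (h1.zero_mul_isBoundedUnder_le b2)
  rw [sub_zero] at h3
  refine h3.congr fun R => ?_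
  have hm : ∀ c : ℝ → ℝ, Continuous c → (∀ x, |c x| ≤ 1) →
      IntegrableOn (fun x => f x * ((c x : ℝ) : 𝕜)) s := fun c hc hc1 =>
    hf.mul_bdd (c := 1) (RCLike.continuous_ofReal.comp hc).aestronglyMeasurable
      (Eventually.of_forall fun x => by simpa using hc1 x)
  rw [← integral_mul_const, ← integral_mul_const, ← integral_sub
    ((hm _ (by fun_prop) fun x => Real.abs_sin_le_one _).mul_const _)
    ((hm _ (by fun_prop) fun x => Real.abs_cos_le_one _).mul_const _)]
  refine integral_congr_ae (Eventually.of_forall fun x => ?_)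
  simp only [mul_sub, Real.sin_sub]
  push_cast
  ring

theorem tendsto_setIntegral_mul_im_exp {𝕜 : Type*} [RCLike 𝕜] {f : ℝ → 𝕜} {s : Set ℝ}
    (hs : MeasurableSet s) (hf : IntegrableOn f s) (L : ℂ) :
    Tendsto (fun R : ℝ => ∫ x in s, f x *
      (((Complex.exp ((x * R : ℝ) * Complex.I) * L).im : ℝ) : 𝕜)) atTop (𝓝 0) := by
  obtain ⟨h1, h2⟩ := tendsto_setIntegral_mul_cos_and_sin hs hf
  have h3 := (h1.mul_const ((L.im : ℝ) : 𝕜)).add (h2.mul_const ((L.re : ℝ) : 𝕜))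
  rw [zero_mul, zero_mul, add_zero] at h3
  refine h3.congr fun R => ?_
  have hm : ∀ c : ℝ → ℝ, Continuous c → (∀ x, |c x| ≤ 1) →
      IntegrableOn (fun x => f x * ((c x : ℝ) : 𝕜)) s := fun c hc hc1 =>
    hf.mul_bdd (c := 1) (RCLike.continuous_ofReal.comp hc).aestronglyMeasurable
      (Eventually.of_forall fun x => by simpa using hc1 x)
  rw [← integral_mul_const, ← integral_mul_const, ← integral_add
    ((hm _ (by fun_prop) fun x => Real.abs_cos_le_one _).mul_const _)
    ((hm _ (by fun_prop) fun x => Real.abs_sin_le_one _).mul_const _)]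
  refine integral_congr_ae (Eventually.of_forall fun x => ?_)
  simp only [Complex.mul_im, Complex.exp_ofReal_mul_I_re, Complex.exp_ofReal_mul_I_im, mul_comm R]
  push_cast
  ring

/-- Within δ of a the quotient is bounded; farther away 1/|x - a| is at most 1/δ and f itself is
integrable. -/
theorem integrableOn_mul_inv_sub_of_isBigO {𝕜 : Type*} [RCLike 𝕜] {f : ℝ → 𝕜} {s : Set ℝ} {a : ℝ}
    (hf : IntegrableOn f s) (hO : f =O[𝓝[≠] a] fun x => x - a) :
    IntegrableOn (fun x => f x * (((x - a)⁻¹ : ℝ) : 𝕜)) s := by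
  obtain ⟨M, hM⟩ := hO.bound
  obtain ⟨δ, hδ, hball⟩ := Metric.mem_nhdsWithin_iff.1 hM
  have hI : IntegrableOn (fun x => (Ioo (a - δ) (a + δ)).indicator (fun _ => |M|) x +
      ‖f x‖ * δ⁻¹) s := by
    refine Integrable.add (Integrable.integrableOn ?_) (hf.norm.mul_const _)
    exact (integrable_indicator_iff measurableSet_Ioo).2 (by simp)
  refine hI.mono' (hf.aestronglyMeasurable.mul ?_) (Eventually.of_forall fun x => ?_)
  · exact (RCLike.measurable_ofReal.comp (by fun_prop)).aestronglyMeasurable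
  rw [norm_mul, RCLike.norm_ofReal, abs_inv]
  have h0 : 0 ≤ (Ioo (a - δ) (a + δ)).indicator (fun _ => |M|) x :=
    indicator_nonneg (fun _ _ => abs_nonneg M) x
  rcases eq_or_ne x a with rfl | hx
  · simp only [sub_self, abs_zero, inv_zero, mul_zero]
    positivity
  have hxa : 0 < |x - a| := abs_pos.2 (sub_ne_zero.2 hx)
  by_cases h : |x - a| < δ
  · have h1 : ‖f x‖ ≤ M * ‖x - a‖ := hball ⟨by simpa [Real.dist_eq] using h, hx⟩
    have h2 : x ∈ Ioo (a - δ) (a + δ) := by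
      rw [abs_lt] at h
      exact ⟨by linarith [h.1], by linarith [h.2]⟩
    rw [indicator_of_mem h2]
    rw [← div_eq_mul_inv]
    have h3 : ‖f x‖ / |x - a| ≤ M := (div_le_iff₀ hxa).2 h1
    have h4 := le_abs_self M
    have : 0 ≤ ‖f x‖ * δ⁻¹ := by positivity
    linarith
  · have : ‖f x‖ * |x - a|⁻¹ ≤ ‖f x‖ * δ⁻¹ := by
      gcongr
      exact not_lt.1 h
    linarith

/-- Dirichlet-type localization on the half-line. -/
theorem tendsto_setIntegral_mul_sinc_sub {𝕜 : Type*} [RCLike 𝕜] {ψ : ℝ → 𝕜} {a : ℝ} (ha : 0 < a)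
    {ψr ψl : 𝕜} (hψ : IntegrableOn ψ (Ioi 0))
    (hr : (fun x => ψ x - ψr) =O[𝓝[>] a] fun x => x - a)
    (hl : (fun x => ψ x - ψl) =O[𝓝[<] a] fun x => x - a) :
    Tendsto (fun R : ℝ =>
      (∫ x in Ioi (0 : ℝ), ψ x * ((R * Real.sinc (R * (x - a)) : ℝ) : 𝕜)) -
        ((∫ t in (0 : ℝ)..a, R * Real.sinc (R * t) : ℝ) : 𝕜) * (ψr + ψl)) atTop (𝓝 0) := by
  -- Subtracting this step function leaves a difference O(x - a), to which Riemann–Lebesgue applies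
  -- after division by x - a. The right step ends at 2a so that both steps have length a and give
  -- the same integral of the even kernel.
  set σ : ℝ → 𝕜 := fun x => (Ioc 0 a).indicator (fun _ => ψl) x +
    (Ioc a (2 * a)).indicator (fun _ => ψr) x with hσ
  have hind : ∀ (b c : ℝ) (y : 𝕜), Integrable ((Ioc b c).indicator fun _ => y) := fun b c y =>
    (integrable_indicator_iff measurableSet_Ioc).2 (by simp)
  have hσi : Integrable σ := (hind _ _ _).add (hind _ _ _)
  have hd : IntegrableOn (fun x => ψ x - σ x) (Ioi 0) := hψ.sub hσi.integrableOn
  have hO : (fun x => ψ x - σ x) =O[𝓝[≠] a] fun x => x - a := by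
    rw [← nhdsLT_sup_nhdsGT]
    refine Asymptotics.IsBigO.sup (hl.congr' ?_ EventuallyEq.rfl) (hr.congr' ?_ EventuallyEq.rfl)
    · filter_upwards [Ioo_mem_nhdsLT ha] with x hx
      simp [hσ, hx.1, hx.2.le]
    · filter_upwards [Ioo_mem_nhdsGT (show a < 2 * a by linarith)] with x hx
      simp [hσ, hx.1, hx.2.le]
  have hχ := integrableOn_mul_inv_sub_of_isBigO hd hO
  refine (tendsto_setIntegral_mul_sin_sub measurableSet_Ioi hχ a).congr' ?_
  filter_upwards [eventually_gt_atTop 0] with R hR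
  have hc : Continuous fun x => ((R * Real.sinc (R * (x - a)) : ℝ) : 𝕜) := by
    have := Real.continuous_sinc
    exact RCLike.continuous_ofReal.comp (by fun_prop)
  have hcb : ∀ x, ‖((R * Real.sinc (R * (x - a)) : ℝ) : 𝕜)‖ ≤ R := fun x => by
    rw [RCLike.norm_ofReal, abs_mul, abs_of_pos hR]
    exact mul_le_of_le_one_right hR.le (Real.abs_sinc_le_one _)
  have e1 : (∫ x in Ioi (0 : ℝ), (ψ x - σ x) * (((x - a)⁻¹ : ℝ) : 𝕜) *
      ((Real.sin (R * (x - a)) : ℝ) : 𝕜)) =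
      ∫ x in Ioi (0 : ℝ), (ψ x - σ x) * ((R * Real.sinc (R * (x - a)) : ℝ) : 𝕜) := by
    refine integral_congr_ae ?_
    have : ∀ᵐ x ∂(volume.restrict (Ioi (0 : ℝ))), x ≠ a :=
      ae_restrict_of_ae (Measure.ae_ne volume a)
    filter_upwards [this] with x hx
    have hxa : x - a ≠ 0 := sub_ne_zero.2 hx
    rw [mul_assoc, ← RCLike.ofReal_mul, Real.sinc_of_ne_zero (mul_ne_zero hR.ne' hxa)]
    congr 2
    field_simp
  have hmul : ∀ f : ℝ → 𝕜, IntegrableOn f (Ioi 0) → IntegrableOn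
      (fun x => f x * ((R * Real.sinc (R * (x - a)) : ℝ) : 𝕜)) (Ioi 0) := fun f hf =>
    hf.mul_bdd (c := R) hc.aestronglyMeasurable (Eventually.of_forall hcb)
  have hstep : ∀ b c : ℝ, 0 ≤ b → b ≤ c → ∀ y : 𝕜, (∫ x in Ioi (0 : ℝ),
      (Ioc b c).indicator (fun _ => y) x * ((R * Real.sinc (R * (x - a)) : ℝ) : 𝕜)) =
      ((∫ x in b..c, R * Real.sinc (R * (x - a)) : ℝ) : 𝕜) * y := by
    intro b c hb hbc y
    have e : (fun x => (Ioc b c).indicator (fun _ => y) x *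
        ((R * Real.sinc (R * (x - a)) : ℝ) : 𝕜)) =
        (Ioc b c).indicator fun x => ((R * Real.sinc (R * (x - a)) : ℝ) : 𝕜) * y := by
      funext x
      by_cases hx : x ∈ Ioc b c <;> simp [hx, mul_comm]
    rw [e, setIntegral_indicator measurableSet_Ioc, inter_eq_right.2
      (Ioc_subset_Ioi_self.trans (Ioi_subset_Ioi hb)), integral_mul_const, integral_ofReal,
      intervalIntegral.integral_of_le hbc]
  have e3 : (∫ x in (0 : ℝ)..a, R * Real.sinc (R * (x - a))) =
      ∫ t in (0 : ℝ)..a, R * Real.sinc (R * t) := by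
    have := intervalIntegral.integral_comp_sub_left (a := 0) (b := a)
      (fun t => R * Real.sinc (R * t)) a
    rw [sub_self, sub_zero] at this
    rw [← this]
    refine intervalIntegral.integral_congr fun x _ => ?_
    rw [← Real.sinc_neg, ← mul_neg, neg_sub]
  have e4 : (∫ x in a..2 * a, R * Real.sinc (R * (x - a))) =
      ∫ t in (0 : ℝ)..a, R * Real.sinc (R * t) := by
    rw [intervalIntegral.integral_comp_sub_right (fun t => R * Real.sinc (R * t)) a]
    rw [sub_self, show 2 * a - a = a by ring]
  have e2 : (∫ x in Ioi (0 : ℝ), σ x * ((R * Real.sinc (R * (x - a)) : ℝ) : 𝕜)) =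
      ((∫ t in (0 : ℝ)..a, R * Real.sinc (R * t) : ℝ) : 𝕜) * (ψr + ψl) := by
    simp only [hσ, add_mul]
    rw [integral_add (hmul _ (hind _ _ _).integrableOn) (hmul _ (hind _ _ _).integrableOn),
      hstep 0 a le_rfl ha.le, hstep a (2 * a) ha.le (by linarith), e3, e4]
    ring
  rw [e1, ← e2, ← integral_sub (hmul _ hψ) (hmul _ hσi.integrableOn)]
  simp only [sub_mul]

/-! ### Measurability and bounds for the parts of the Hankel kernel. -/

theorem measurable_besselW {ν : ℝ} (hν : -1 < ν) : Measurable (besselW ν) := by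
  have h0 := measurable_besselJ hν
  have h1 := measurable_besselJ (by linarith : -1 < ν + 1)
  have e : besselW ν = fun y : ℝ => ((√y * besselJ ν y : ℝ) : ℂ) +
      ((√y * besselJ (ν + 1) y : ℝ) : ℂ) * Complex.I :=
    funext fun y => (Complex.re_add_im (besselW ν y)).symm
  rw [e]
  fun_prop

theorem measurable_besselAmp {ν : ℝ} (hν : -1 < ν) : Measurable (besselAmp ν) := by
  have := measurable_besselW hν
  unfold besselAmp
  fun_prop

theorem measurable_hankelError {ν : ℝ} (hν : -1 < ν) (a R : ℝ) :
    Measurable (hankelError ν a R) := by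
  have := measurable_besselAmp hν
  unfold hankelError
  exact (Complex.measurable_im.comp (by fun_prop)).div (by fun_prop)

theorem measurable_hankelWeight (a : ℝ) : Measurable (hankelWeight a) := by
  unfold hankelWeight
  fun_prop

theorem hankelWeight_nonneg {a x : ℝ} (ha : 0 < a) (hx : 0 < x) : 0 ≤ hankelWeight a x := by
  unfold hankelWeight
  positivity

theorem exists_norm_besselW_mul_le {ν : ℝ} (hν : -1 < ν) :
    ∃ M, 0 ≤ M ∧ ∀ R x, 0 < R → 0 < x → ‖besselW ν (x * R)‖ ≤
      M * (1 + R ^ min (ν + 1 / 2) 0) * (1 + x ^ min (ν + 1 / 2) 0) := by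
  obtain ⟨C, hC0, hC⟩ := exists_norm_besselW_le hν
  refine ⟨C, hC0, fun R x hR hx => (hC _ (by positivity)).trans ?_⟩
  rw [mul_assoc, mul_comm (1 + R ^ _)]
  gcongr
  exact one_add_rpow_mul_le _ hx.le hR.le

theorem abs_hankelError_le (ν a R x : ℝ) : |hankelError ν a R x| ≤
    ‖besselAmp ν (x * R) - besselAmp ν (a * R)‖ * ‖besselAmp ν (a * R)‖ / |x - a| := by
  rw [hankelError, abs_div]
  gcongr
  refine (Complex.abs_im_le_norm _).trans ?_
  rw [norm_mul, Complex.norm_exp_ofReal_mul_I, one_mul, norm_mul, RCLike.norm_conj]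

theorem exists_abs_hankelError_le {a ν : ℝ} (ha : 0 < a) (hν : -1 < ν) :
    ∃ M, 0 ≤ M ∧ ∀ R x, 0 < R → 0 < x → |hankelError ν a R x| ≤
      M * (1 + R ^ min (ν + 1 / 2) 0) ^ 2 * (1 + x ^ min (ν + 1 / 2) 0) := by
  obtain ⟨C, hC0, hC⟩ := exists_norm_besselAmp_sub_le ha hν
  obtain ⟨M, hM0, hM⟩ := exists_norm_besselW_mul_le hν
  refine ⟨C * (M * (1 + a ^ min (ν + 1 / 2) 0)), by positivity, fun R x hR hx => ?_⟩
  refine (abs_hankelError_le ν a R x).trans ?_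
  -- At x = a both quotients are 0 by the convention for division by zero.
  rcases eq_or_ne x a with rfl | hxa
  · simp only [sub_self, abs_zero, div_zero]
    positivity
  have hxa' : 0 < |x - a| := abs_pos.2 (sub_ne_zero.2 hxa)
  rw [div_le_iff₀ hxa', norm_besselAmp ν (a * R)]
  calc _ ≤ _ := mul_le_mul (hC R x hR hx) (hM R a hR ha) (norm_nonneg _) (by positivity)
    _ = _ := by ring

/-- Serves absolute convergence at fixed R, so the constant may grow with R. -/
theorem exists_abs_mul_integral_besselJ_le {a ν R : ℝ} (ha : 0 < a) (hν : -1 < ν) (hR : 0 < R) :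
    ∃ C, 0 ≤ C ∧ ∀ x, 0 < x → x ≠ a →
      |x * ∫ t in (0 : ℝ)..R, besselJ ν (x * t) * besselJ ν (a * t) * t| ≤
        C * (hankelWeight a x * (1 + x ^ min (ν + 1 / 2) 0)) := by
  obtain ⟨M, hM0, hM⟩ := exists_norm_besselW_mul_le hν
  obtain ⟨N, hN0, hN⟩ := exists_abs_hankelError_le ha hν
  set e := min (ν + 1 / 2) 0
  refine ⟨a * (‖besselAmp ν (a * R)‖ ^ 2 * R + N * (1 + R ^ e) ^ 2) +
    M * (1 + R ^ e) * ‖besselW ν (a * R)‖, by positivity, fun x hx hxa => ?_⟩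
  have hw := hankelWeight_nonneg ha hx
  have hx1 : 1 ≤ 1 + x ^ e := le_add_of_nonneg_right (by positivity)
  rw [mul_integral_besselJ_mul_besselJ ha hν hR hx hxa, abs_mul, abs_of_nonneg hw]
  have h1 : |‖besselAmp ν (a * R)‖ ^ 2 * (R * Real.sinc (R * (x - a)))| ≤
      ‖besselAmp ν (a * R)‖ ^ 2 * R * (1 + x ^ e) := by
    rw [abs_mul, abs_mul, abs_of_pos hR, abs_of_nonneg (by positivity), mul_assoc]
    gcongr
    exact (Real.abs_sinc_le_one _).trans hx1
  have h2 : |(besselW ν (x * R)).im * (besselW ν (a * R)).re| ≤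
      M * (1 + R ^ e) * (1 + x ^ e) * ‖besselW ν (a * R)‖ := by
    rw [abs_mul]
    gcongr
    · exact (Complex.abs_im_le_norm _).trans (hM R x hR hx)
    · exact Complex.abs_re_le_norm _
  have h3 : |a * (‖besselAmp ν (a * R)‖ ^ 2 * (R * Real.sinc (R * (x - a))) +
      hankelError ν a R x) + (besselW ν (x * R)).im * (besselW ν (a * R)).re| ≤
      a * (‖besselAmp ν (a * R)‖ ^ 2 * R * (1 + x ^ e) + N * (1 + R ^ e) ^ 2 * (1 + x ^ e)) +
      M * (1 + R ^ e) * (1 + x ^ e) * ‖besselW ν (a * R)‖ := by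
    refine (abs_add_le _ _).trans (add_le_add ?_ h2)
    rw [abs_mul, abs_of_pos ha]
    gcongr
    exact (abs_add_le _ _).trans (add_le_add h1 (hN R x hR hx))
  calc _ ≤ _ := mul_le_mul_of_nonneg_left h3 hw
    _ = _ := by ring

theorem ae_restrict_Ioi_pos_and_ne (a : ℝ) :
    ∀ᵐ x ∂(volume.restrict (Ioi (0 : ℝ))), 0 < x ∧ x ≠ a := by
  filter_upwards [ae_restrict_mem measurableSet_Ioi, ae_restrict_of_ae (Measure.ae_ne volume a)]
    with x hx hxa using ⟨hx, hxa⟩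

theorem integrableOn_mul_hankelKernel {𝕜 : Type*} [RCLike 𝕜] {a ν R : ℝ} (ha : 0 < a)
    (hν : -1 < ν) (hR : 0 < R) {φ : ℝ → 𝕜}
    (hφm : AEStronglyMeasurable φ (volume.restrict (Ioi 0)))
    (hφi : IntegrableOn (fun x => hankelWeight a x * (1 + x ^ min (ν + 1 / 2) 0) * ‖φ x‖)
      (Ioi 0)) :
    IntegrableOn (fun x : ℝ => φ x *
        ((x * ∫ t in (0 : ℝ)..R, besselJ ν (x * t) * besselJ ν (a * t) * t : ℝ) : 𝕜)) (Ioi 0) := by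
  obtain ⟨C, hC0, hC⟩ := exists_abs_mul_integral_besselJ_le ha hν hR
  have hae := ae_restrict_Ioi_pos_and_ne a
  refine (hφi.const_mul C).mono' (hφm.mul ?_) ?_
  · have hw := measurable_besselW hν
    have hE := measurable_hankelError hν a R
    have hh := measurable_hankelWeight a
    have hs := Real.continuous_sinc.measurable
    have him : Measurable fun x => (besselW ν (x * R)).im :=
      Complex.measurable_im.comp (by fun_prop)
    have hm : Measurable fun x => hankelWeight a x * (a * (‖besselAmp ν (a * R)‖ ^ 2 *
        (R * Real.sinc (R * (x - a))) + hankelError ν a R x) +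
          (besselW ν (x * R)).im * (besselW ν (a * R)).re) := by
      fun_prop
    refine AEStronglyMeasurable.congr
      (RCLike.measurable_ofReal.comp hm).aestronglyMeasurable ?_
    filter_upwards [hae] with x hx
    rw [Function.comp_apply, mul_integral_besselJ_mul_besselJ ha hν hR hx.1 hx.2]
  · filter_upwards [hae] with x hx
    rw [norm_mul, RCLike.norm_ofReal]
    calc _ ≤ ‖φ x‖ * _ := mul_le_mul_of_nonneg_left (hC x hx.1 hx.2) (norm_nonneg _)
      _ = _ := by ring

/-! ### Localization of the truncated Hankel inversion at a. -/

/-- The Dirichlet factor governing the limit of the truncated Hankel inversion at `a`. -/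
noncomputable def dirichletFactor (ν a R : ℝ) : ℝ :=
  ‖besselAmp ν (a * R)‖ ^ 2 * ∫ t in (0 : ℝ)..a, R * Real.sinc (R * t)

theorem rpow_le_one_of_one_le_of_min {ν R : ℝ} (hR : 1 ≤ R) : R ^ min (ν + 1 / 2) 0 ≤ 1 :=
  Real.rpow_le_one_of_one_le_of_nonpos hR (min_le_right _ _)

theorem tendsto_besselAmp_mul {ν x : ℝ} {L : ℂ} (hL : Tendsto (besselAmp ν) atTop (𝓝 L))
    (hx : 0 < x) : Tendsto (fun R => besselAmp ν (x * R)) atTop (𝓝 L) :=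
  hL.comp (tendsto_id.const_mul_atTop hx)

section Localization

variable {𝕜 : Type*} [RCLike 𝕜] {a ν : ℝ} {φ : ℝ → 𝕜}

/-- Pointwise, A(xR) and A(aR) tend to the same limit. For R ≥ 1 the majorant is uniform in R, with
4 bounding the factor (1 + R^e)² for e = min(ν + 1/2, 0). -/
theorem tendsto_setIntegral_mul_hankelError (ha : 0 < a) (hν : -1 < ν)
    (hφm : AEStronglyMeasurable φ (volume.restrict (Ioi 0)))
    (hφi : IntegrableOn (fun x => hankelWeight a x * (1 + x ^ min (ν + 1 / 2) 0) * ‖φ x‖)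
      (Ioi 0)) :
    Tendsto (fun R : ℝ => ∫ x in Ioi (0 : ℝ), φ x *
      ((hankelWeight a x * hankelError ν a R x : ℝ) : 𝕜)) atTop (𝓝 0) := by
  obtain ⟨L, hL⟩ := exists_tendsto_besselAmp hν
  obtain ⟨N, hN0, hN⟩ := exists_abs_hankelError_le ha hν
  have h := tendsto_integral_filter_of_dominated_convergence
    (μ := volume.restrict (Ioi (0 : ℝ))) (l := atTop)
    (F := fun R x => φ x * ((hankelWeight a x * hankelError ν a R x : ℝ) : 𝕜)) (f := fun _ => 0)
    (fun x => N * 4 * (hankelWeight a x * (1 + x ^ min (ν + 1 / 2) 0) * ‖φ x‖)) ?_ ?_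
    (hφi.const_mul _) ?_
  · simpa using h
  · refine Eventually.of_forall fun R => hφm.mul ?_
    exact (RCLike.measurable_ofReal.comp
      ((measurable_hankelWeight a).mul (measurable_hankelError hν a R))).aestronglyMeasurable
  · filter_upwards [eventually_ge_atTop 1] with R hR
    have hR0 : 0 < R := by linarith
    filter_upwards [ae_restrict_mem measurableSet_Ioi] with x hx
    have hx : 0 < x := hx
    have hw := hankelWeight_nonneg ha hx
    rw [norm_mul, RCLike.norm_ofReal, abs_mul, abs_of_nonneg hw]
    have h1 : |hankelError ν a R x| ≤ N * 4 * (1 + x ^ min (ν + 1 / 2) 0) := by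
      refine (hN R x hR0 hx).trans ?_
      gcongr
      have := rpow_le_one_of_one_le_of_min (ν := ν) hR
      have h0 : 0 ≤ R ^ min (ν + 1 / 2) 0 := by positivity
      nlinarith
    calc _ ≤ ‖φ x‖ * (hankelWeight a x * (N * 4 * (1 + x ^ min (ν + 1 / 2) 0))) := by gcongr
      _ = _ := by ring
  · filter_upwards [ae_restrict_mem measurableSet_Ioi] with x hx
    have hx : 0 < x := hx
    have h1 : Tendsto (fun R => ‖besselAmp ν (x * R) - besselAmp ν (a * R)‖ *
        ‖besselAmp ν (a * R)‖ / |x - a|) atTop (𝓝 0) := by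
      simpa using ((((tendsto_besselAmp_mul hL hx).sub (tendsto_besselAmp_mul hL ha)).norm).mul
        (tendsto_besselAmp_mul hL ha).norm).div_const |x - a|
    have h2 : Tendsto (fun R => hankelError ν a R x) atTop (𝓝 0) :=
      squeeze_zero_norm (fun R => abs_hankelError_le ν a R x) h1
    have h3 := ((RCLike.continuous_ofReal (K := 𝕜)).tendsto _).comp
      (h2.const_mul (hankelWeight a x))
    simpa [Function.comp_def] using h3.const_mul (φ x)

theorem integrableOn_mul_hankelWeight (ha : 0 < a)
    (hφm : AEStronglyMeasurable φ (volume.restrict (Ioi 0)))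
    (hφi : IntegrableOn (fun x => hankelWeight a x * (1 + x ^ min (ν + 1 / 2) 0) * ‖φ x‖)
      (Ioi 0)) :
    IntegrableOn (fun x => φ x * ((hankelWeight a x : ℝ) : 𝕜)) (Ioi 0) := by
  refine hφi.mono' (hφm.mul
    (RCLike.measurable_ofReal.comp (measurable_hankelWeight a)).aestronglyMeasurable) ?_
  filter_upwards [ae_restrict_mem measurableSet_Ioi] with x hx
  have hx : 0 < x := hx
  have hw := hankelWeight_nonneg ha hx
  rw [norm_mul, RCLike.norm_ofReal, abs_of_nonneg hw, mul_comm]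
  gcongr
  exact le_mul_of_one_le_right hw (le_add_of_nonneg_right (by positivity))

/-- Replace W(xR) by e^{ixR} L with L the limit amplitude. The difference tends to 0 by dominated
convergence, and the pure exponential falls to Riemann–Lebesgue. -/
theorem tendsto_setIntegral_mul_im_besselW (ha : 0 < a) (hν : -1 < ν)
    (hφm : AEStronglyMeasurable φ (volume.restrict (Ioi 0)))
    (hφi : IntegrableOn (fun x => hankelWeight a x * (1 + x ^ min (ν + 1 / 2) 0) * ‖φ x‖)
      (Ioi 0)) :
    Tendsto (fun R : ℝ => ∫ x in Ioi (0 : ℝ), φ x *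
      ((hankelWeight a x * (besselW ν (x * R)).im : ℝ) : 𝕜)) atTop (𝓝 0) := by
  obtain ⟨L, hL⟩ := exists_tendsto_besselAmp hν
  obtain ⟨M, hM0, hM⟩ := exists_norm_besselW_mul_le hν
  set e := min (ν + 1 / 2) 0 with he
  set D : ℝ → ℝ → ℝ := fun R x =>
    (besselW ν (x * R)).im - (Complex.exp ((x * R : ℝ) * Complex.I) * L).im with hD
  have hwI := integrableOn_mul_hankelWeight ha hφm hφi
  have hRL := tendsto_setIntegral_mul_im_exp measurableSet_Ioi hwI L
  have hDn : ∀ R x, |D R x| ≤ ‖besselAmp ν (x * R) - L‖ := by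
    intro R x
    have : D R x = (Complex.exp ((x * R : ℝ) * Complex.I) * (besselAmp ν (x * R) - L)).im := by
      simp only [hD]
      rw [besselW_eq_exp_mul_besselAmp, mul_sub, Complex.sub_im]
    rw [this]
    refine (Complex.abs_im_le_norm _).trans ?_
    rw [norm_mul, Complex.norm_exp_ofReal_mul_I, one_mul]
  have hDm : ∀ R, Measurable (D R) := fun R => by
    have hw := measurable_besselW hν
    exact (Complex.measurable_im.comp (by fun_prop)).sub (Complex.measurable_im.comp (by fun_prop))
  have hmeas : ∀ R, AEStronglyMeasurable
      (fun x => φ x * ((hankelWeight a x * D R x : ℝ) : 𝕜)) (volume.restrict (Ioi 0)) := fun R =>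
    hφm.mul (RCLike.measurable_ofReal.comp
      ((measurable_hankelWeight a).mul (hDm R))).aestronglyMeasurable
  have hbound : ∀ R, 1 ≤ R → ∀ᵐ x ∂(volume.restrict (Ioi (0 : ℝ))),
      ‖φ x * ((hankelWeight a x * D R x : ℝ) : 𝕜)‖ ≤
        (M * 2 + ‖L‖) * (hankelWeight a x * (1 + x ^ e) * ‖φ x‖) := by
    intro R hR
    have hR0 : 0 < R := by linarith
    filter_upwards [ae_restrict_mem measurableSet_Ioi] with x hx
    have hx : 0 < x := hx
    have hw := hankelWeight_nonneg ha hx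
    rw [norm_mul, RCLike.norm_ofReal, abs_mul, abs_of_nonneg hw]
    have hR1 : R ^ e ≤ 1 := rpow_le_one_of_one_le_of_min hR
    have hx0 : 0 ≤ x ^ e := by positivity
    have h1 : |D R x| ≤ (M * 2 + ‖L‖) * (1 + x ^ e) := by
      refine (hDn R x).trans ((norm_sub_le _ _).trans ?_)
      rw [add_mul, norm_besselAmp]
      refine add_le_add ((hM R x hR0 hx).trans ?_) ?_
      · gcongr
        linarith
      · exact le_mul_of_one_le_right (norm_nonneg _) (by linarith)
    calc _ ≤ ‖φ x‖ * (hankelWeight a x * ((M * 2 + ‖L‖) * (1 + x ^ e))) := by gcongr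
      _ = _ := by ring
  have hDT : Tendsto (fun R : ℝ => ∫ x in Ioi (0 : ℝ), φ x *
      ((hankelWeight a x * D R x : ℝ) : 𝕜)) atTop (𝓝 0) := by
    have h := tendsto_integral_filter_of_dominated_convergence
      (μ := volume.restrict (Ioi (0 : ℝ))) (l := atTop)
      (F := fun R x => φ x * ((hankelWeight a x * D R x : ℝ) : 𝕜)) (f := fun _ => 0)
      (fun x => (M * 2 + ‖L‖) * (hankelWeight a x * (1 + x ^ e) * ‖φ x‖))
      (Eventually.of_forall hmeas) ((eventually_ge_atTop 1).mono hbound) (hφi.const_mul _) ?_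
    · simpa using h
    · filter_upwards [ae_restrict_mem measurableSet_Ioi] with x hx
      have hx : 0 < x := hx
      have h1 : Tendsto (fun R => ‖besselAmp ν (x * R) - L‖) atTop (𝓝 0) := by
        simpa using ((tendsto_besselAmp_mul hL hx).sub_const L).norm
      have h2 : Tendsto (fun R => D R x) atTop (𝓝 0) :=
        squeeze_zero_norm (fun R => hDn R x) h1
      have h3 := ((RCLike.continuous_ofReal (K := 𝕜)).tendsto _).comp
        (h2.const_mul (hankelWeight a x))
      simpa [Function.comp_def] using h3.const_mul (φ x)
  have hsum := hDT.add hRL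
  rw [add_zero] at hsum
  refine hsum.congr' ?_
  filter_upwards [eventually_ge_atTop 1] with R hR
  rw [← integral_add ((hφi.const_mul (M * 2 + ‖L‖)).mono' (hmeas R) (hbound R hR))]
  · refine integral_congr_ae (Eventually.of_forall fun x => ?_)
    simp only [hD]
    push_cast
    ring
  · refine hwI.mul_bdd (c := ‖L‖) ?_ (Eventually.of_forall fun x => ?_)
    · exact (RCLike.measurable_ofReal.comp
        (Complex.measurable_im.comp (by fun_prop))).aestronglyMeasurable
    · rw [RCLike.norm_ofReal]
      refine (Complex.abs_im_le_norm _).trans ?_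
      rw [norm_mul, Complex.norm_exp_ofReal_mul_I, one_mul]

/-- The smooth weight satisfies a · `hankelWeight a a` = 1/2, which is the source of the factor ½ in
the theorem. -/
theorem isBigO_mul_hankelWeight_sub (ha : 0 < a) {l : Filter ℝ} (hl : l ≤ 𝓝 a) {y : 𝕜}
    (h : (fun x => φ x - y) =O[l] fun x => x - a) :
    (fun x => φ x * ((a * hankelWeight a x : ℝ) : 𝕜) - y / 2) =O[l] fun x => x - a := by
  have hd : DifferentiableAt ℝ (fun x => a * hankelWeight a x) a := by
    unfold hankelWeight
    have h1 : DifferentiableAt ℝ (fun x : ℝ => √x) a := (Real.hasDerivAt_sqrt ha.ne').differentiableAt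
    have h2 : a + a ≠ 0 := by positivity
    fun_prop (disch := assumption)
  have hval : a * hankelWeight a a = 1 / 2 := by
    have : √a ≠ 0 := (Real.sqrt_pos.2 ha).ne'
    unfold hankelWeight
    field_simp
    ring
  have h1 : (fun x => ((a * hankelWeight a x - 1 / 2 : ℝ) : 𝕜)) =O[l] fun x => x - a := by
    have := hd.isBigO_sub.mono hl
    rw [hval] at this
    refine Asymptotics.IsBigO.of_norm_left (this.norm_left.congr_left fun x => ?_)
    rw [RCLike.norm_ofReal, Real.norm_eq_abs]
  have h2 : (fun x => ((a * hankelWeight a x : ℝ) : 𝕜)) =O[l] fun _ => (1 : ℝ) := by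
    have : Tendsto (fun x => ((a * hankelWeight a x : ℝ) : 𝕜)) l _ :=
      ((RCLike.continuous_ofReal (K := 𝕜)).tendsto _).comp (hd.continuousAt.tendsto.mono_left hl)
    exact this.isBigO_one ℝ
  have h3 := ((h.mul h2).congr_right fun x => mul_one _).add (h1.const_mul_left y)
  refine h3.congr_left fun x => ?_
  push_cast
  ring

/-- The limit is established up to a scalar factor depending on ν, a and R but not on φ. A single
function with known inversion then determines the limit of that factor. -/
theorem tendsto_setIntegral_hankelKernel_sub (ha : 0 < a) (hν : -1 < ν)
    (hφm : AEStronglyMeasurable φ (volume.restrict (Ioi 0)))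
    (hφi : IntegrableOn (fun x => hankelWeight a x * (1 + x ^ min (ν + 1 / 2) 0) * ‖φ x‖)
      (Ioi 0)) {φr φl : 𝕜}
    (hr : (fun x => φ x - φr) =O[𝓝[>] a] fun x => x - a)
    (hl : (fun x => φ x - φl) =O[𝓝[<] a] fun x => x - a) :
    Tendsto (fun R : ℝ => (∫ x in Ioi (0 : ℝ), φ x *
        ((x * ∫ t in (0 : ℝ)..R, besselJ ν (x * t) * besselJ ν (a * t) * t : ℝ) : 𝕜)) -
        ((dirichletFactor ν a R : ℝ) : 𝕜) * (1 / 2 * (φr + φl))) atTop (𝓝 0) := by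
  obtain ⟨L, hL⟩ := exists_tendsto_besselAmp hν
  have hgb := (tendsto_besselAmp_mul hL ha).norm
  have hwI := integrableOn_mul_hankelWeight ha hφm hφi
  have hψ : IntegrableOn (fun x => φ x * ((a * hankelWeight a x : ℝ) : 𝕜)) (Ioi 0) := by
    refine (hwI.const_mul ((a : ℝ) : 𝕜)).congr (Eventually.of_forall fun x => ?_)
    push_cast
    ring
  have hA := tendsto_setIntegral_mul_sinc_sub ha hψ
    (isBigO_mul_hankelWeight_sub ha nhdsWithin_le_nhds hr)
    (isBigO_mul_hankelWeight_sub ha nhdsWithin_le_nhds hl)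
  have hB := (tendsto_setIntegral_mul_hankelError ha hν hφm hφi).const_mul ((a : ℝ) : 𝕜)
  have hC := tendsto_setIntegral_mul_im_besselW ha hν hφm hφi
  have hA' := (((RCLike.continuous_ofReal (K := 𝕜)).tendsto _).comp (hgb.pow 2)).mul hA
  have hbd : IsBoundedUnder (· ≤ ·) atTop
      fun R : ℝ => ‖(((besselW ν (a * R)).re : ℝ) : 𝕜)‖ := by
    refine hgb.isBoundedUnder_le.mono_le (Eventually.of_forall fun R => ?_)
    simp only
    rw [RCLike.norm_ofReal, norm_besselAmp]
    exact Complex.abs_re_le_norm _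
  have hC' := hC.zero_mul_isBoundedUnder_le hbd
  have hsum := (hA'.add hB).add hC'
  rw [mul_zero, mul_zero, add_zero, add_zero] at hsum
  refine hsum.congr' ?_
  obtain ⟨M, hM0, hM⟩ := exists_norm_besselW_mul_le hν
  obtain ⟨N, hN0, hN⟩ := exists_abs_hankelError_le ha hν
  filter_upwards [eventually_gt_atTop 0] with R hR
  have hi1 : IntegrableOn (fun x => φ x * ((a * hankelWeight a x : ℝ) : 𝕜) *
      ((R * Real.sinc (R * (x - a)) : ℝ) : 𝕜)) (Ioi 0) := by
    have hc := Real.continuous_sinc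
    refine hψ.mul_bdd (c := R)
      (RCLike.continuous_ofReal.comp (by fun_prop)).aestronglyMeasurable
      (Eventually.of_forall fun x => ?_)
    rw [RCLike.norm_ofReal, abs_mul, abs_of_pos hR]
    exact mul_le_of_le_one_right hR.le (Real.abs_sinc_le_one _)
  have hi : ∀ (f : ℝ → ℝ) (C : ℝ), Measurable f →
      (∀ x, 0 < x → |f x| ≤ C * (1 + x ^ min (ν + 1 / 2) 0)) →
      IntegrableOn (fun x => φ x * ((hankelWeight a x * f x : ℝ) : 𝕜)) (Ioi 0) := by
    intro f C hf hfC
    refine (hφi.const_mul C).mono' (hφm.mul (RCLike.measurable_ofReal.comp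
      ((measurable_hankelWeight a).mul hf)).aestronglyMeasurable) ?_
    filter_upwards [ae_restrict_mem measurableSet_Ioi] with x hx
    have hx : 0 < x := hx
    have hw := hankelWeight_nonneg ha hx
    rw [norm_mul, RCLike.norm_ofReal, abs_mul, abs_of_nonneg hw]
    calc _ ≤ ‖φ x‖ * (hankelWeight a x * (C * (1 + x ^ min (ν + 1 / 2) 0))) := by
          gcongr
          exact hfC x hx
      _ = _ := by ring
  have hi2 := hi _ _ (measurable_hankelError hν a R) (fun x hx => hN R x hR hx)
  have hi3 := hi (fun x => (besselW ν (x * R)).im) _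
    (Complex.measurable_im.comp ((measurable_besselW hν).comp (by fun_prop)))
    (fun x hx => (Complex.abs_im_le_norm _).trans (hM R x hR hx))
  have hi12 : IntegrableOn (fun x => ((‖besselAmp ν (a * R)‖ ^ 2 : ℝ) : 𝕜) * (φ x *
        ((a * hankelWeight a x : ℝ) : 𝕜) * ((R * Real.sinc (R * (x - a)) : ℝ) : 𝕜)) +
      ((a : ℝ) : 𝕜) * (φ x * ((hankelWeight a x * hankelError ν a R x : ℝ) : 𝕜))) (Ioi 0) :=
    (hi1.const_mul _).add (hi2.const_mul _)
  have hsplit : (∫ x in Ioi (0 : ℝ), φ x *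
      ((x * ∫ t in (0 : ℝ)..R, besselJ ν (x * t) * besselJ ν (a * t) * t : ℝ) : 𝕜)) =
      ((‖besselAmp ν (a * R)‖ ^ 2 : ℝ) : 𝕜) * (∫ x in Ioi (0 : ℝ), φ x *
        ((a * hankelWeight a x : ℝ) : 𝕜) * ((R * Real.sinc (R * (x - a)) : ℝ) : 𝕜)) +
      ((a : ℝ) : 𝕜) * (∫ x in Ioi (0 : ℝ), φ x *
        ((hankelWeight a x * hankelError ν a R x : ℝ) : 𝕜)) +
      (∫ x in Ioi (0 : ℝ), φ x * ((hankelWeight a x * (besselW ν (x * R)).im : ℝ) : 𝕜)) *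
        (((besselW ν (a * R)).re : ℝ) : 𝕜) := by
    rw [← integral_const_mul, ← integral_const_mul, ← integral_mul_const,
      ← integral_add (hi1.const_mul _) (hi2.const_mul _),
      ← integral_add hi12 (hi3.mul_const _)]
    refine integral_congr_ae ?_
    filter_upwards [ae_restrict_Ioi_pos_and_ne a] with x hx
    rw [mul_integral_besselJ_mul_besselJ ha hν hR hx.1 hx.2]
    push_cast
    ring
  rw [hsplit, dirichletFactor]
  simp only [Function.comp_apply]
  push_cast
  ring

end Localization

/-! ### The self-reciprocal Gaussian and the limit of the Dirichlet factor. -/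

/-- The majorant `√x (1 + x^e) x^ν e^{-x²/2}` of the self-reciprocal Gaussian. -/
noncomputable def gaussianMajorant (ν x : ℝ) : ℝ :=
  √x * (1 + x ^ min (ν + 1 / 2) 0) * (x ^ ν * Real.exp (-(1 / 2) * x ^ 2))

theorem integrableOn_gaussianMajorant {ν : ℝ} (hν : -1 < ν) :
    IntegrableOn (gaussianMajorant ν) (Ioi 0) := by
  have he := neg_one_lt_two_mul_min hν
  have h1 := integrableOn_rpow_mul_exp_neg_mul_sq (b := 1 / 2) (by norm_num)
    (s := ν + 1 / 2) (by linarith)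
  have h2 := integrableOn_rpow_mul_exp_neg_mul_sq (b := 1 / 2) (by norm_num)
    (s := ν + 1 / 2 + min (ν + 1 / 2) 0) (by
      rcases min_cases (ν + 1 / 2) 0 with h | h <;> linarith)
  refine (h1.add h2).congr ?_
  filter_upwards [ae_restrict_mem measurableSet_Ioi] with x hx
  have hx : 0 < x := hx
  rw [Pi.add_apply, gaussianMajorant, Real.rpow_add hx (ν + 1 / 2), Real.rpow_add hx ν,
    Real.sqrt_eq_rpow]
  ring

theorem exists_norm_gaussian_mul_besselJ_le {a ν : ℝ} (ha : 0 < a) (hν : -1 < ν) :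
    ∃ C, 0 ≤ C ∧ ∀ x t, 0 < x → 0 < t →
      ‖x ^ ν * Real.exp (-(1 / 2) * x ^ 2) *
        (x * (besselJ ν (x * t) * besselJ ν (a * t) * t))‖ ≤
        gaussianMajorant ν x * (C * (1 + t ^ min (ν + 1 / 2) 0) ^ 2) := by
  obtain ⟨C, hC0, hC⟩ := exists_norm_besselJ_mul_besselJ_le ha hν
  refine ⟨C, hC0, fun x t hx ht => ?_⟩
  have hs : x * (√x)⁻¹ = √x := by
    rw [← div_eq_mul_inv, Real.div_sqrt]
  rw [norm_mul, norm_mul x, Real.norm_of_nonneg (by positivity : 0 ≤ x ^ ν * Real.exp (-(1 / 2) * x ^ 2)),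
    Real.norm_of_nonneg hx.le]
  have hp : 0 ≤ x ^ ν * Real.exp (-(1 / 2) * x ^ 2) := by positivity
  calc _ ≤ x ^ ν * Real.exp (-(1 / 2) * x ^ 2) * (x * (C * ((√x)⁻¹ *
        (1 + x ^ min (ν + 1 / 2) 0)) * (1 + t ^ min (ν + 1 / 2) 0) ^ 2)) :=
        mul_le_mul_of_nonneg_left (mul_le_mul_of_nonneg_left (hC x t hx ht) hx.le) hp
    _ = (x * (√x)⁻¹) * (1 + x ^ min (ν + 1 / 2) 0) * (x ^ ν * Real.exp (-(1 / 2) * x ^ 2)) *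
        (C * (1 + t ^ min (ν + 1 / 2) 0) ^ 2) := by ring
    _ = _ := by rw [hs, gaussianMajorant]

theorem integral_rpow_mul_gaussian {ν : ℝ} (hν : -1 < ν) (n : ℕ) :
    ∫ x in Ioi (0 : ℝ), x ^ (2 * ν + 2 * n + 1) * Real.exp (-(1 / 2) * x ^ 2) =
      2 ^ ν * 2 ^ n * Real.Gamma (n + ν + 1) := by
  have hn : (0 : ℝ) ≤ n := n.cast_nonneg
  have h := integral_rpow_mul_exp_neg_mul_rpow (p := 2) (q := 2 * ν + 2 * n + 1) (b := 1 / 2)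
    (by norm_num) (by linarith) (by norm_num)
  simp only [Real.rpow_two] at h
  rw [h, show (2 * ν + 2 * n + 1 + 1) / 2 = n + ν + 1 by ring,
    show -(2 * ν + 2 * n + 1 + 1) / 2 = -(ν + n + 1) by ring, one_div, Real.inv_rpow (by norm_num),
    Real.rpow_neg (by norm_num), inv_inv, Real.rpow_add_one (by norm_num),
    Real.rpow_add (by norm_num), Real.rpow_natCast]
  ring

/-- The function `x^ν e^{-x²/2}` is its own Hankel transform. -/
theorem integral_gaussian_mul_besselJ {ν t : ℝ} (hν : -1 < ν) (ht : 0 < t) :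
    ∫ x in Ioi (0 : ℝ), x ^ ν * Real.exp (-(1 / 2) * x ^ 2) * (x * besselJ ν (x * t)) =
      t ^ ν * Real.exp (-(1 / 2) * t ^ 2) := by
  obtain ⟨b, hb⟩ : ∃ b : ℕ → ℝ, b = fun n : ℕ => (-1) ^ n /
      (Real.Gamma (n + ν + 1) * (n.factorial : ℝ)) * (t / 2) ^ (2 * n) * (t / 2) ^ ν := ⟨_, rfl⟩
  set F : ℕ → ℝ → ℝ := fun n x =>
    b n * (x ^ (2 * ν + 2 * n + 1) * Real.exp (-(1 / 2) * x ^ 2)) with hF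
  have hFi : ∀ n, IntegrableOn (F n) (Ioi 0) := fun n => by
    have hn : (0 : ℝ) ≤ n := n.cast_nonneg
    exact (integrableOn_rpow_mul_exp_neg_mul_sq (by norm_num) (by linarith)).const_mul _
  have hbI : ∀ n, b n * (2 ^ ν * 2 ^ n * Real.Gamma (n + ν + 1)) =
      t ^ ν * ((-(1 / 2) * t ^ 2) ^ n / n.factorial) := by
    intro n
    have hn : (0 : ℝ) ≤ n := n.cast_nonneg
    have hG : Real.Gamma (n + ν + 1) ≠ 0 := (Real.Gamma_pos_of_pos (by linarith)).ne'
    have h3 : (n.factorial : ℝ) ≠ 0 := by positivity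
    have h4 : (-(1 / 2) * t ^ 2) ^ n = (-1) ^ n * (t / 2) ^ (2 * n) * 2 ^ n := by
      rw [pow_mul, ← mul_pow, ← mul_pow]
      ring
    rw [h4, hb]
    simp only
    rw [Real.div_rpow ht.le (by norm_num)]
    have h5 : (2 : ℝ) ^ ν ≠ 0 := by positivity
    field_simp
  have hFint : ∀ n, ∫ x in Ioi (0 : ℝ), F n x =
      t ^ ν * ((-(1 / 2) * t ^ 2) ^ n / n.factorial) := fun n => by
    simp only [hF]
    rw [integral_const_mul, integral_rpow_mul_gaussian hν, hbI]
  -- The absolute integrals sum to t^ν e^{t²/2}, which justifies integrating the Bessel series term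
  -- by term.
  have hFnorm : ∀ n, ∫ x in Ioi (0 : ℝ), ‖F n x‖ =
      t ^ ν * ((1 / 2 * t ^ 2) ^ n / n.factorial) := fun n => by
    have e : ∫ x in Ioi (0 : ℝ), ‖F n x‖ = ∫ x in Ioi (0 : ℝ),
        |b n| * (x ^ (2 * ν + 2 * n + 1) * Real.exp (-(1 / 2) * x ^ 2)) := by
      refine setIntegral_congr_fun measurableSet_Ioi fun x hx => ?_
      have hx : 0 < x := hx
      simp only [hF]
      rw [norm_mul, Real.norm_eq_abs, Real.norm_of_nonneg (by positivity)]
    have hn : (0 : ℝ) ≤ n := n.cast_nonneg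
    have hG : 0 < Real.Gamma (n + ν + 1) := Real.Gamma_pos_of_pos (by linarith)
    rw [e, integral_const_mul, integral_rpow_mul_gaussian hν]
    have h1 : |b n| * (2 ^ ν * 2 ^ n * Real.Gamma (n + ν + 1)) =
        |b n * (2 ^ ν * 2 ^ n * Real.Gamma (n + ν + 1))| := by
      rw [abs_mul, abs_of_pos (by positivity : 0 < 2 ^ ν * 2 ^ n * Real.Gamma (n + ν + 1))]
    have h2 : |-(1 / 2) * t ^ 2| = 1 / 2 * t ^ 2 := by
      rw [neg_mul, abs_neg, abs_of_nonneg (by positivity)]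
    rw [h1, hbI, abs_mul, abs_div, abs_pow, h2, Nat.abs_cast,
      abs_of_pos (Real.rpow_pos_of_pos ht ν)]
  have hsum := hasSum_integral_of_summable_integral_norm hFi (by
    simp only [hFnorm]
    exact (Real.summable_pow_div_factorial _).mul_left _)
  simp only [hFint] at hsum
  have hexp : HasSum (fun n : ℕ => t ^ ν * ((-(1 / 2) * t ^ 2) ^ n / n.factorial))
      (t ^ ν * Real.exp (-(1 / 2) * t ^ 2)) := by
    have h := NormedSpace.expSeries_div_hasSum_exp (-(1 / 2) * t ^ 2)
    rw [← Real.exp_eq_exp_ℝ] at h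
    exact h.mul_left (t ^ ν)
  rw [← hsum.unique hexp]
  refine setIntegral_congr_fun measurableSet_Ioi fun x hx => ?_
  have hx : 0 < x := hx
  simp only [hF]
  rw [besselJ, ← mul_assoc, ← mul_assoc, ← tsum_mul_left]
  refine tsum_congr fun n => ?_
  simp only [hb]
  rw [show x * t / 2 = x * (t / 2) by ring, Real.mul_rpow hx.le (by positivity), mul_pow,
    Real.rpow_add_one hx.ne', Real.rpow_add hx, two_mul ν, Real.rpow_add hx,
    show (2 : ℝ) * n = ((2 * n : ℕ) : ℝ) by push_cast; ring, Real.rpow_natCast]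
  ring

theorem integrableOn_gaussian_mul_besselJ {ν t : ℝ} (hν : -1 < ν) (ht : 0 < t) :
    IntegrableOn (fun x : ℝ => x ^ ν * Real.exp (-(1 / 2) * x ^ 2) * (x * besselJ ν (x * t)))
      (Ioi 0) := by
  obtain ⟨M, hM0, hM⟩ := exists_norm_besselW_mul_le hν
  refine ((integrableOn_gaussianMajorant hν).const_mul
    (M * (1 + t ^ min (ν + 1 / 2) 0) * (√t)⁻¹)).mono' ?_ ?_
  · have := measurable_besselJ hν
    exact (by fun_prop : Measurable _).aestronglyMeasurable
  · filter_upwards [ae_restrict_mem measurableSet_Ioi] with x hx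
    have hx : 0 < x := hx
    have hsx : 0 < √x := Real.sqrt_pos.2 hx
    have hst : 0 < √t := Real.sqrt_pos.2 ht
    have h1 : √x * √t * |besselJ ν (x * t)| ≤
        M * (1 + t ^ min (ν + 1 / 2) 0) * (1 + x ^ min (ν + 1 / 2) 0) := by
      refine le_trans ?_ (hM t x ht hx)
      refine le_trans (le_of_eq ?_) (Complex.abs_re_le_norm _)
      rw [besselW, abs_mul, abs_of_nonneg (Real.sqrt_nonneg _), Real.sqrt_mul hx.le]
    rw [norm_mul, norm_mul x, Real.norm_of_nonneg (by positivity : 0 ≤ x ^ ν * Real.exp (-(1 / 2) * x ^ 2)),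
    Real.norm_of_nonneg hx.le,
      Real.norm_eq_abs]
    calc x ^ ν * Real.exp (-(1 / 2) * x ^ 2) * (x * |besselJ ν (x * t)|)
        = x ^ ν * Real.exp (-(1 / 2) * x ^ 2) * (√x * (√t)⁻¹) *
          (√x * √t * |besselJ ν (x * t)|) := by
          field_simp
          rw [Real.sq_sqrt hx.le]
          ring
      _ ≤ x ^ ν * Real.exp (-(1 / 2) * x ^ 2) * (√x * (√t)⁻¹) *
          (M * (1 + t ^ min (ν + 1 / 2) 0) * (1 + x ^ min (ν + 1 / 2) 0)) := by gcongr
      _ = _ := by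
          rw [gaussianMajorant]
          ring

/-- Fubini, with a product majorant in x and t, followed by self-reciprocity in x for each fixed t.
-/
theorem integral_gaussian_mul_hankelKernel {a ν R : ℝ} (ha : 0 < a) (hν : -1 < ν) (hR : 0 < R) :
    ∫ x in Ioi (0 : ℝ), x ^ ν * Real.exp (-(1 / 2) * x ^ 2) *
        (x * ∫ t in (0 : ℝ)..R, besselJ ν (x * t) * besselJ ν (a * t) * t) =
      ∫ t in (0 : ℝ)..R, t ^ ν * Real.exp (-(1 / 2) * t ^ 2) * (t * besselJ ν (t * a)) := by
  obtain ⟨C, hC0, hC⟩ := exists_norm_gaussian_mul_besselJ_le ha hν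
  have hm := measurable_besselJ hν
  have hI : Integrable (fun p : ℝ × ℝ => p.1 ^ ν * Real.exp (-(1 / 2) * p.1 ^ 2) *
      (p.1 * (besselJ ν (p.1 * p.2) * besselJ ν (a * p.2) * p.2)))
      ((volume.restrict (Ioi (0 : ℝ))).prod (volume.restrict (Ioc 0 R))) := by
    have h2 := (intervalIntegrable_iff_integrableOn_Ioc_of_le hR.le).1
      ((intervalIntegrable_one_add_rpow_sq (neg_one_lt_two_mul_min hν) 0 R le_rfl
        hR.le).const_mul C)
    refine ((integrableOn_gaussianMajorant hν).mul_prod h2).mono' ?_ ?_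
    · exact (by fun_prop : Measurable _).aestronglyMeasurable
    · rw [Measure.prod_restrict]
      filter_upwards [ae_restrict_mem (measurableSet_Ioi.prod measurableSet_Ioc)] with p hp
      exact hC p.1 p.2 hp.1 hp.2.1
  calc _ = ∫ x in Ioi (0 : ℝ), ∫ t in Ioc 0 R, x ^ ν * Real.exp (-(1 / 2) * x ^ 2) *
        (x * (besselJ ν (x * t) * besselJ ν (a * t) * t)) := by
        refine integral_congr_ae (Eventually.of_forall fun x => ?_)
        simp only
        rw [intervalIntegral.integral_of_le hR.le, ← integral_const_mul, ← integral_const_mul]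
    _ = ∫ t in Ioc 0 R, ∫ x in Ioi (0 : ℝ), x ^ ν * Real.exp (-(1 / 2) * x ^ 2) *
        (x * (besselJ ν (x * t) * besselJ ν (a * t) * t)) := integral_integral_swap hI
    _ = _ := by
        rw [intervalIntegral.integral_of_le hR.le]
        refine setIntegral_congr_fun measurableSet_Ioc fun t ht => ?_
        rw [← mul_assoc, mul_right_comm, ← integral_gaussian_mul_besselJ hν ht.1,
          ← integral_mul_const, ← integral_mul_const]
        refine integral_congr_ae (Eventually.of_forall fun x => ?_)
        simp only [mul_comm t a]
        ring

/-- For φ(x) = x^ν e^{-x²/2} the truncated inversion is a truncated Hankel transform of φ, which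
tends to φ(a) by a second use of self-reciprocity. By localization it is also `dirichletFactor` ·
φ(a) + o(1). As φ(a) ≠ 0, the factor tends to 1. -/
theorem tendsto_dirichletFactor {a ν : ℝ} (ha : 0 < a) (hν : -1 < ν) :
    Tendsto (dirichletFactor ν a) atTop (𝓝 1) := by
  set φ : ℝ → ℝ := fun x => x ^ ν * Real.exp (-(1 / 2) * x ^ 2) with hφ
  have hφa : φ a ≠ 0 := by
    simp only [hφ]
    positivity
  have hφm : Measurable φ := by fun_prop
  have hd : DifferentiableAt ℝ φ a := by
    have : DifferentiableAt ℝ (fun x : ℝ => x ^ ν) a :=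
      (Real.hasDerivAt_rpow_const (Or.inl ha.ne')).differentiableAt
    fun_prop
  have hO := hd.isBigO_sub
  have hφi : IntegrableOn (fun x => hankelWeight a x * (1 + x ^ min (ν + 1 / 2) 0) * ‖φ x‖)
      (Ioi 0) := by
    refine ((integrableOn_gaussianMajorant hν).const_mul ((√a)⁻¹ * a⁻¹)).mono' ?_ ?_
    · have := measurable_hankelWeight a
      exact (by fun_prop : Measurable _).aestronglyMeasurable
    · filter_upwards [ae_restrict_mem measurableSet_Ioi] with x hx
      have hx : 0 < x := hx
      have hw := hankelWeight_nonneg ha hx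
      have h1 : ‖φ x‖ = φ x := Real.norm_of_nonneg (by simp only [hφ]; positivity)
      have h2 : 0 ≤ φ x := h1 ▸ norm_nonneg _
      have h3 : hankelWeight a x ≤ (√a)⁻¹ * a⁻¹ * √x := by
        have hsa : 0 < √a := Real.sqrt_pos.2 ha
        unfold hankelWeight
        rw [div_div, ← mul_inv, ← div_eq_inv_mul]
        gcongr
        linarith
      rw [h1, Real.norm_of_nonneg (by positivity)]
      calc hankelWeight a x * (1 + x ^ min (ν + 1 / 2) 0) * φ x
          ≤ (√a)⁻¹ * a⁻¹ * √x * (1 + x ^ min (ν + 1 / 2) 0) * φ x := by gcongr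
        _ = _ := by
          rw [gaussianMajorant]
          ring
  have h1 := tendsto_setIntegral_hankelKernel_sub ha hν hφm.aestronglyMeasurable hφi
    (hO.mono nhdsWithin_le_nhds) (hO.mono nhdsWithin_le_nhds)
  have h2 := intervalIntegral_tendsto_integral_Ioi 0 (integrableOn_gaussian_mul_besselJ hν ha)
    tendsto_id
  rw [integral_gaussian_mul_besselJ hν ha] at h2
  have h3 := (h2.sub h1).div_const (φ a)
  rw [sub_zero, div_self hφa] at h3
  refine h3.congr' ?_
  filter_upwards [eventually_gt_atTop 0] with R hR
  have h4 := integral_gaussian_mul_hankelKernel ha hν hR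
  have h5 : ∫ x in Ioi (0 : ℝ), φ x *
      (x * ∫ t in (0 : ℝ)..R, besselJ ν (x * t) * besselJ ν (a * t) * t) = _ := h4
  simp only [id, RCLike.ofReal_real_eq_id]
  rw [h5]
  generalize (∫ t in (0 : ℝ)..R,
    t ^ ν * Real.exp (-(1 / 2) * t ^ 2) * (t * besselJ ν (t * a))) = I
  field_simp
  ring

/-! ### Consequences of piecewise continuous differentiability. -/

section PiecewiseC1

variable {𝕜 : Type*} [RCLike 𝕜] {φ : ℝ → 𝕜} {S : Set ℝ}

theorem eventually_notMem_of_finite_inter_Icc (hS : ∀ c d : ℝ, 0 < c → (S ∩ Icc c d).Finite)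
    {x : ℝ} (hx : 0 < x) : ∀ᶠ y in 𝓝 x, y ≠ x → y ∉ S := by
  have hfin : ((S ∩ Icc (x / 2) (2 * x)) \ {x}).Finite := (hS _ _ (by positivity)).sdiff
  have h1 := hfin.isClosed.isOpen_compl.mem_nhds (x := x) (by simp)
  filter_upwards [h1, Icc_mem_nhds (show x / 2 < x by linarith) (show x < 2 * x by linarith)]
    with y hy hy' hne hyS
  exact hy ⟨⟨hyS, hy'⟩, hne⟩

theorem Ioi_diff_mem_nhds_of_finite_inter_Icc (hS : ∀ c d : ℝ, 0 < c → (S ∩ Icc c d).Finite)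
    {x : ℝ} (hx : 0 < x) (hxS : x ∉ S) : Ioi 0 \ S ∈ 𝓝 x := by
  filter_upwards [eventually_notMem_of_finite_inter_Icc hS hx, Ioi_mem_nhds hx] with y hy hy0
  refine ⟨hy0, ?_⟩
  rcases eq_or_ne y x with rfl | h
  · exact hxS
  · exact hy h

/-- The derivative is bounded near a, so the mean value inequality holds between two points x, y of
s near a; letting y → a replaces φ(y) by the limit l. When a ∉ s, the value φ(a) plays no role. -/
theorem isBigO_sub_of_tendsto_deriv {s : Set ℝ} (hs : Convex ℝ s) {a : ℝ} [(𝓝[s] a).NeBot]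
    {l m : 𝕜} (hl : Tendsto φ (𝓝[s] a) (𝓝 l)) (hm : Tendsto (deriv φ) (𝓝[s] a) (𝓝 m))
    (hd : ∀ᶠ x in 𝓝[s] a, DifferentiableAt ℝ φ x) :
    (fun x => φ x - l) =O[𝓝[s] a] fun x => x - a := by
  have hb : ∀ᶠ x in 𝓝[s] a, ‖deriv φ x‖ ≤ ‖m‖ + 1 :=
    (hm.norm.eventually_lt_const (lt_add_one _)).mono fun _ h => h.le
  obtain ⟨δ, hδ, hball⟩ := Metric.mem_nhdsWithin_iff.1 (hd.and hb)
  have hmem : Metric.ball a δ ∩ s ∈ 𝓝[s] a :=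
    inter_mem (mem_nhdsWithin_of_mem_nhds (Metric.ball_mem_nhds a hδ)) self_mem_nhdsWithin
  have hconv : Convex ℝ (Metric.ball a δ ∩ s) := (convex_ball a δ).inter hs
  refine Asymptotics.IsBigO.of_bound (‖m‖ + 1) ?_
  filter_upwards [hmem] with x hx
  have h1 : Tendsto (fun y => ‖φ x - φ y‖) (𝓝[s] a) (𝓝 ‖φ x - l‖) := (hl.const_sub _).norm
  have h2 : Tendsto (fun y => (‖m‖ + 1) * ‖x - y‖) (𝓝[s] a) (𝓝 ((‖m‖ + 1) * ‖x - a‖)) := by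
    have : Continuous fun y : ℝ => (‖m‖ + 1) * ‖x - y‖ := by fun_prop
    exact (this.tendsto a).mono_left nhdsWithin_le_nhds
  refine le_of_tendsto_of_tendsto h1 h2 ?_
  filter_upwards [hmem] with y hy
  exact hconv.norm_image_sub_le_of_norm_deriv_le (fun z hz => (hball hz).1)
    (fun z hz => (hball hz).2) hy hx

theorem PiecewiseC1OnPos.exists_isBigO_sub (hφ : PiecewiseC1OnPos φ) {a : ℝ} (ha : 0 < a) :
    ∃ φr φl : 𝕜, ((fun x => φ x - φr) =O[𝓝[>] a] fun x => x - a) ∧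
      ((fun x => φ x - φl) =O[𝓝[<] a] fun x => x - a) := by
  obtain ⟨S, hS, hC, hlim⟩ := hφ
  have hdiff : ∀ x, 0 < x → x ∉ S → DifferentiableAt ℝ φ x := fun x hx hxS =>
    (hC.contDiffAt (Ioi_diff_mem_nhds_of_finite_inter_Icc hS hx hxS)).differentiableAt one_ne_zero
  by_cases haS : a ∈ S
  · obtain ⟨⟨l₁, h₁⟩, ⟨l₂, h₂⟩, ⟨m₁, hm₁⟩, ⟨m₂, hm₂⟩⟩ := hlim a haS ha
    have hev : ∀ s : Set ℝ, a ∉ s → ∀ᶠ x in 𝓝[s] a, DifferentiableAt ℝ φ x := by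
      intro s has
      filter_upwards [mem_nhdsWithin_of_mem_nhds (eventually_notMem_of_finite_inter_Icc hS ha),
        mem_nhdsWithin_of_mem_nhds (Ioi_mem_nhds ha), self_mem_nhdsWithin] with x hx hx0 hxs
      exact hdiff x hx0 (hx fun h => has (h ▸ hxs))
    exact ⟨l₂, l₁, isBigO_sub_of_tendsto_deriv (convex_Ioi a) h₂ hm₂ (hev _ (lt_irrefl a)),
      isBigO_sub_of_tendsto_deriv (convex_Iio a) h₁ hm₁ (hev _ (lt_irrefl a))⟩
  · have hO := (hdiff a ha haS).isBigO_sub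
    exact ⟨φ a, φ a, hO.mono nhdsWithin_le_nhds, hO.mono nhdsWithin_le_nhds⟩

/-- The exceptional points in (0, ∞) form a countable, hence null, set, by exhaustion with the
intervals [1/(n+1), n]; on the open complement φ is continuous. -/
theorem PiecewiseC1OnPos.aestronglyMeasurable (hφ : PiecewiseC1OnPos φ) :
    AEStronglyMeasurable φ (volume.restrict (Ioi 0)) := by
  obtain ⟨S, hS, hC, -⟩ := hφ
  have hopen : IsOpen (Ioi 0 \ S) := isOpen_iff_mem_nhds.2 fun x hx =>
    Ioi_diff_mem_nhds_of_finite_inter_Icc hS hx.1 hx.2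
  have hcount : (Ioi 0 ∩ S).Countable := by
    refine (countable_iUnion fun n : ℕ =>
      (hS (1 / ((n : ℝ) + 1)) n (by positivity)).countable).mono fun x hx => ?_
    have hx0 : 0 < x := hx.1
    obtain ⟨m, hm⟩ := exists_nat_one_div_lt hx0
    obtain ⟨k, hk⟩ := exists_nat_ge x
    refine mem_iUnion.2 ⟨max m k, hx.2, ?_, hk.trans (by exact_mod_cast le_max_right m k)⟩
    refine le_trans (one_div_le_one_div_of_le (by positivity) ?_) hm.le
    gcongr
    exact le_max_left m k
  have hae : (Ioi 0 \ S : Set ℝ) =ᵐ[volume] Ioi 0 := by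
    rw [← sdiff_self_inter]
    exact sdiff_null_ae_eq_self (hcount.measure_zero _)
  rw [← Measure.restrict_congr_set hae]
  exact hC.continuousOn.aestronglyMeasurable hopen.measurableSet

end PiecewiseC1

/-! ### Integrability against the weight, and the conclusion. -/

/-- The weight is at most a constant times √x near 0 and x^{-1/2} at infinity. The exponent 1/2 +
min(ν + 1/2, 0) is 1/2 for ν ≥ -1/2 and ν + 1 otherwise, which unites the two integrability
conditions at the origin. -/
theorem integrableOn_hankelWeight_mul_norm {𝕜 : Type*} [RCLike 𝕜] {a ν : ℝ} (ha : 0 < a)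
    {φ : ℝ → 𝕜} (hφm : AEStronglyMeasurable φ (volume.restrict (Ioi 0)))
    (hinf : IntegrableOn (fun x : ℝ => x ^ (-(1 / 2) : ℝ) * ‖φ x‖) (Ioi 1))
    (hzero : IntegrableOn (fun x : ℝ => x ^ (1 / 2 + min (ν + 1 / 2) 0) * ‖φ x‖) (Ioc 0 1)) :
    IntegrableOn (fun x => hankelWeight a x * (1 + x ^ min (ν + 1 / 2) 0) * ‖φ x‖) (Ioi 0) := by
  set e := min (ν + 1 / 2) 0 with he
  have he0 : e ≤ 0 := min_le_right _ _
  have hsa : 0 < √a := Real.sqrt_pos.2 ha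
  have hmeas : AEStronglyMeasurable
      (fun x => hankelWeight a x * (1 + x ^ e) * ‖φ x‖) (volume.restrict (Ioi 0)) := by
    have := measurable_hankelWeight a
    exact (by fun_prop : Measurable fun x => hankelWeight a x * (1 + x ^ e)).aestronglyMeasurable.mul
      hφm.norm
  rw [← Ioc_union_Ioi_eq_Ioi zero_le_one]
  refine IntegrableOn.union ?_ ?_
  · refine (hzero.const_mul ((√a)⁻¹ * a⁻¹ * 2)).mono'
      (hmeas.mono_measure (Measure.restrict_mono Ioc_subset_Ioi_self le_rfl)) ?_
    filter_upwards [ae_restrict_mem measurableSet_Ioc] with x hx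
    have hx0 : 0 < x := hx.1
    have hw := hankelWeight_nonneg ha hx0
    have h3 : hankelWeight a x ≤ (√a)⁻¹ * a⁻¹ * √x := by
      unfold hankelWeight
      rw [div_div, ← mul_inv, ← div_eq_inv_mul]
      gcongr
      linarith
    have h4 : 1 ≤ x ^ e := Real.one_le_rpow_of_pos_of_le_one_of_nonpos hx0 hx.2 he0
    rw [Real.norm_of_nonneg (by positivity), Real.rpow_add hx0, ← Real.sqrt_eq_rpow]
    calc _ ≤ (√a)⁻¹ * a⁻¹ * √x * (x ^ e + x ^ e) * ‖φ x‖ := by gcongr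
      _ = _ := by ring
  · refine (hinf.const_mul ((√a)⁻¹ * 2)).mono'
      (hmeas.mono_measure (Measure.restrict_mono (Ioi_subset_Ioi zero_le_one) le_rfl)) ?_
    filter_upwards [ae_restrict_mem measurableSet_Ioi] with x hx
    have hx1 : 1 < x := hx
    have hx0 : 0 < x := by linarith
    have hw := hankelWeight_nonneg ha hx0
    have h3 : hankelWeight a x ≤ (√a)⁻¹ * x ^ (-(1 / 2) : ℝ) := by
      have h5 : x ^ (-(1 / 2) : ℝ) = √x / x := by
        rw [Real.rpow_neg hx0.le, ← Real.sqrt_eq_rpow, Real.sqrt_div_self']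
        exact (one_div _).symm
      rw [h5, hankelWeight, div_div, ← div_eq_inv_mul, div_div, mul_comm x]
      gcongr
      linarith
    have h4 : x ^ e ≤ 1 := Real.rpow_le_one_of_one_le_of_nonpos hx1.le he0
    rw [Real.norm_of_nonneg (by positivity)]
    calc _ ≤ (√a)⁻¹ * x ^ (-(1 / 2) : ℝ) * (1 + 1) * ‖φ x‖ := by gcongr
      _ = _ := by ring

theorem theorem1 {𝕜 : Type*} [RCLike 𝕜] (a ν : ℝ) (ha : 0 < a) (hν : -1 < ν)
    (φ : ℝ → 𝕜) (hφ : PiecewiseC1OnPos φ)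
    (hinf : IntegrableOn (fun x : ℝ => x ^ (-(1 / 2) : ℝ) * ‖φ x‖) (Ioi 1))
    (hzero : -(1 / 2) ≤ ν →
      IntegrableOn (fun x : ℝ => x ^ (1 / 2 : ℝ) * ‖φ x‖) (Ioc 0 1))
    (hzero' : ν < -(1 / 2) →
      IntegrableOn (fun x : ℝ => x ^ (ν + 1) * ‖φ x‖) (Ioc 0 1)) :
    (∀ R : ℝ, 0 < R → ∀ x : ℝ, 0 < x →
      IntervalIntegrable (fun t : ℝ => besselJ ν (x * t) * besselJ ν (a * t) * t) volume 0 R) ∧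
    (∀ R : ℝ, 0 < R →
      IntegrableOn (fun x : ℝ => φ x *
        ((x * ∫ t in (0 : ℝ)..R, besselJ ν (x * t) * besselJ ν (a * t) * t : ℝ) : 𝕜)) (Ioi 0)) ∧
    ∃ φr φl : 𝕜,
      Tendsto φ (𝓝[>] a) (𝓝 φr) ∧ Tendsto φ (𝓝[<] a) (𝓝 φl) ∧
      Tendsto
        (fun R : ℝ => ∫ x in Ioi (0 : ℝ), φ x *
          ((x * ∫ t in (0 : ℝ)..R, besselJ ν (x * t) * besselJ ν (a * t) * t : ℝ) : 𝕜))
        atTop (𝓝 (1 / 2 * (φr + φl))) := by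
  have hφm := hφ.aestronglyMeasurable
  have hφi := integrableOn_hankelWeight_mul_norm (ν := ν) ha hφm hinf (by
    rcases le_or_gt (-(1 / 2)) ν with h | h
    · rw [min_eq_right (by linarith), add_zero]
      exact hzero h
    · rw [min_eq_left (by linarith), show 1 / 2 + (ν + 1 / 2) = ν + 1 by ring]
      exact hzero' h)
  obtain ⟨φr, φl, hr, hl⟩ := hφ.exists_isBigO_sub ha
  refine ⟨fun R hR x hx => intervalIntegrable_besselJ_mul_besselJ ha hν hR hx,
    fun R hR => integrableOn_mul_hankelKernel ha hν hR hφm hφi, φr, φl, ?_, ?_, ?_⟩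
  · have h0 : Tendsto (fun x => x - a) (𝓝[>] a) (𝓝 0) := by
      simpa using ((continuous_sub_right a).tendsto a).mono_left nhdsWithin_le_nhds
    exact tendsto_sub_nhds_zero_iff.1 (hr.trans_tendsto h0)
  · have h0 : Tendsto (fun x => x - a) (𝓝[<] a) (𝓝 0) := by
      simpa using ((continuous_sub_right a).tendsto a).mono_left nhdsWithin_le_nhds
    exact tendsto_sub_nhds_zero_iff.1 (hl.trans_tendsto h0)
  · have h1 := tendsto_setIntegral_hankelKernel_sub ha hν hφm hφi hr hl
    have h2 := (((RCLike.continuous_ofReal (K := 𝕜)).tendsto _).comp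
      (tendsto_dirichletFactor ha hν)).mul_const (1 / 2 * (φr + φl))
    have h3 := h1.add h2
    rw [zero_add, RCLike.ofReal_one, one_mul] at h3
    exact h3.congr fun R => sub_add_cancel _ _
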